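/- Let $\mathbb T^2=[0,1]^2$ be the two-dimensional torus and, for $f\in L^1(\mathbb T^2)$, let $\hat f(k)=\int_{\mathbb T^2} f(x)e^{-2\pi i k\cdot x}\,dx$, $k\in\mathbb Z^2$. Let $e^{-t\Delta^2}$ be the semigroup generated by $-\Delta^2$, that is, $\widehat{e^{-t\Delta^2}f}(k)=e^{-t(2\pi|k|)^4}\hat f(k)$. For $2<p<3$ consider $$\partial_t u+\Delta^2u=-\nabla\cdot\big(|\nabla u|^{p-2}\nabla u\big)\ \text{ on }\mathbb T^2,\qquad u(0,\cdot)=u_0 .$$ A function $u\in C([0,T];L^2(\mathbb T^2))$, real-valued, whose spatial distributional gradient $\nabla u$ is integrable on $[0,T]\times\mathbb T^2$, is called a mild solution on $[0,T]$ with initial data $u_0\in L^2(\mathbb T^2)$ if $|\nabla u(s)|^{p-1}\in L^1(\mathbb T^2)$ for almost every $s\in[0,T]$ and, for every $0\le t\le T$, it is a fixed point of the Duhamel map: $$u(t)=\mathcal T(u)(t):=e^{-t\Delta^2}u_0-\int_0^t\nabla\cdot e^{-(t-s)\Delta^2}\big(|\nabla u(s)|^{p-2}\nabla u(s)\big)\,ds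 ,$$ where the integral converges as a Bochner integral with values in $L^2(\mathbb T^2)$. For $T>0$ let $$\tilde{\mathcal S}_T=\Big\{u\in C([0,T];L^2(\mathbb T^2)):\ \sup_{0<t\le T}t^{1/4}\|\nabla u(t)\|_{L^2}<\infty\Big\}.$$ **Theorem.** Let $2<p<3$. For every real-valued $u_0\in L^2(\mathbb T^2)$ there is $0<T\le 1$, depending only on $p$ and $\|u_0\|_{L^2}$, such that the equation has a mild solution $u$ on $[0,T]$ with initial data $u_0$; this solution belongs to $\tilde{\mathcal S}_T$, and it is the only mild solution on $[0,T]$ with initial data $u_0$ in $\tilde{\mathcal S}_T$. -/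

import Mathlib

open MeasureTheory Set
open scoped ENNReal

noncomputable section

namespace ThinFilm

/-- The two-dimensional torus `[0,1]²` with opposite sides identified. -/
abbrev Torus : Type := UnitAddTorus (Fin 2)

/-- Lebesgue measure `dx` on the torus, of total mass one: the product of the normalised Haar
measures of the two circles `ℝ/ℤ`. This is the measure that `UnitAddTorus.mFourierCoeff` uses. -/
abbrev dx : Measure Torus := Measure.pi fun _ => AddCircle.haarAddCircle

/-- `ℝ²` with its Euclidean norm. -/
abbrev Plane : Type := EuclideanSpace ℝ (Fin 2)

/-- The real Hilbert space `L²(𝕋²)` of real-valued functions. -/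
abbrev L2 : Type := Lp ℝ 2 dx

/-- The `k`-th Fourier coefficient `∫ f(x) exp(-2πi k·x) dx` of a real-valued function. -/
def fourierCoeff (f : Torus → ℝ) (k : Fin 2 → ℤ) : ℂ :=
  UnitAddTorus.mFourierCoeff (fun x => (f x : ℂ)) k

/-- The symbol `2πi k_j` of the partial derivative `∂_j` on the torus of side one. -/
def derivSymbol (k : Fin 2 → ℤ) (j : Fin 2) : ℂ :=
  2 * (Real.pi : ℂ) * Complex.I * (k j : ℂ)

/-- The symbol `(2π|k|)⁴` of the bi-Laplacian `Δ²` on the torus of side one. -/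
def biLaplaceSymbol (k : Fin 2 → ℤ) : ℝ :=
  ((2 * Real.pi) ^ 2 * ∑ j, (k j : ℝ) ^ 2) ^ 2

/-- `g` is the distributional gradient of `f`, and both are integrable functions: for all `j` and
`k`, `∫ g_j e_{-k} = -∫ f ∂_j e_{-k}`, where `e_k(x) = exp(2πi k·x)`. The characters span a dense
subspace of the space of smooth test functions on the torus, so testing with them is the same
as testing with all smooth functions. -/
def IsWeakGradient (f : Torus → ℝ) (g : Torus → Plane) : Prop :=
  Integrable f dx ∧ Integrable g dx ∧
    ∀ (k : Fin 2 → ℤ) (j : Fin 2),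
      fourierCoeff (fun x => g x j) k = derivSymbol k j * fourierCoeff f k

open Classical in
/-- The inverse Fourier transform with values in `L²(𝕋²)`: the (unique) real-valued square
integrable function whose Fourier coefficients are `c`, and `0` if there is none. -/
def invFourier (c : (Fin 2 → ℤ) → ℂ) : L2 :=
  if h : ∃ f : L2, ∀ k, fourierCoeff f k = c k then h.choose else 0

/-- The semigroup `e^{-tΔ²}` on `L²(𝕋²)`, a Fourier multiplier. -/
def semigroup (t : ℝ) (f : L2) : L2 :=
  invFourier fun k => (Real.exp (-t * biLaplaceSymbol k) : ℂ) * fourierCoeff f k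

/-- `∇ · e^{-tΔ²} H` for an integrable vector field `H` on the torus. For `t > 0` the Fourier
coefficients on the right are square summable, so that this is an honest element of `L²`. -/
def divSemigroup (t : ℝ) (H : Torus → Plane) : L2 :=
  invFourier fun k => (Real.exp (-t * biLaplaceSymbol k) : ℂ) *
    ∑ j, derivSymbol k j * fourierCoeff (fun x => H x j) k

/-- The nonlinearity `F(ξ) = |ξ|^{p-2} ξ`. -/
def flux (p : ℝ) (ξ : Plane) : Plane := ‖ξ‖ ^ (p - 2) • ξ

/-- The Duhamel map
`𝒯(u)(t) = e^{-tΔ²} u₀ - ∫₀ᵗ ∇ · e^{-(t-s)Δ²} (|∇u(s)|^{p-2} ∇u(s)) ds`,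
where `G s` stands for `∇u(s)`; the integral is a Bochner integral in `L²(𝕋²)`. -/
def duhamel (p : ℝ) (u₀ : L2) (G : ℝ → Lp Plane 1 dx) (t : ℝ) : L2 :=
  semigroup t u₀ - ∫ s in (0 : ℝ)..t, divSemigroup (t - s) (fun x => flux p (G s x))

/-- Mild solutions of `∂ₜu + Δ²u = -∇·(|∇u|^{p-2}∇u)` on `[0,T]` with initial data `u₀`, that is,
fixed points of the Duhamel map. Here `G` is the spatial gradient of `u`; it is (locally)
integrable on the compact set `[0,T] × 𝕋²`, which is expressed through
`L¹([0,T] × 𝕋²) = L¹([0,T]; L¹(𝕋²))`. That the flux at almost every time is integrable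
and that the Duhamel integral converges as a Bochner integral in `L²` is part of the definition. -/
def IsMildSolution (p T : ℝ) (u₀ : L2) (u : ℝ → L2) : Prop :=
  ContinuousOn u (Icc 0 T) ∧
  ∃ G : ℝ → Lp Plane 1 dx,
    IntegrableOn G (Icc 0 T) ∧
    (∀ᵐ s ∂(volume.restrict (Icc 0 T)),
      IsWeakGradient (u s) (G s) ∧ Integrable (fun x => flux p (G s x)) dx) ∧
    ∀ t ∈ Icc 0 T,
      IntervalIntegrable (fun s => divSemigroup (t - s) (fun x => flux p (G s x))) volume 0 t ∧
      u t = duhamel p u₀ G t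

/-- The space `C([0,T]; L²(𝕋²)) ∩ {u : sup_{0 < t ≤ T} t^{1/4} ‖∇u(t)‖_{L²} < ∞}`. -/
def MemSolutionSpace (T : ℝ) (u : ℝ → L2) : Prop :=
  ContinuousOn u (Icc 0 T) ∧
  ∃ M : ℝ, ∀ t ∈ Ioc 0 T, ∃ g : Lp Plane 2 dx,
    IsWeakGradient (u t) g ∧ t ^ (1 / 4 : ℝ) * ‖g‖ ≤ M

end ThinFilm

end

noncomputable section

namespace ThinFilm

open Filter Topology
open scoped ComplexConjugate BoundedContinuousFunction

/-! The unknown of the fixed point problem is the gradient `G = ∇u` rather than `u`. It must satisfy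
`G(t) = ∇e^{-tΔ²}u₀ - ∫₀ᵗ ∇∇·e^{-(t-s)Δ²} F(G(s)) ds` with `F(ξ) = |ξ|^{p-2}ξ`, and `u` is then
recovered from Duhamel's formula.

Two ingredients make this solvable. On the linear side, bounding `e^{-x}` by a negative power of `x`
on the Fourier side shows that `∇e^{-τΔ²}` costs `τ^{-1/4}` on `L²` (`norm_gradHeat_le`), and that
`∇·e^{-τΔ²}` from `L¹` to `L²` costs `τ^{-1/2-ε}` (`norm_divHeat_le`), the loss `ε` paying for
square summability over `ℤ²`. Together `∇∇·e^{-τΔ²}` costs `τ^{-3/4-ε}`. On the nonlinear side, `p -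
2 < 1` makes the flux locally Lipschitz from `L²` to `L¹` (`norm_fluxL1_sub_le`), of size
`s^{-(p-1)/4}` when `‖G(s)‖ ≲ s^{-1/4}`. A Beta integral then bounds the nonlinear term, in the norm
`sup t^{1/4}‖G(t)‖`, by a multiple of `T^{(3-p)/4-ε}`. With `ε = (3-p)/8` this is `T^ε`, and a short
time gives a contraction on a ball whose radius depends only on `‖u₀‖`
(`exists_gradDuhamel_fixedPoint`).

Uniqueness has to hold among all solutions in the class, with no bound on their size and on the same
interval. The smallness therefore comes from a weight `e^{lt}` with `l` large, which gains `l^{-ε}`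
for a further singularity `(t-s)^{-ε}`; the kernel exponent `3/4 + 2ε` is still below one because `p
> 2` (`exists_weighted_contraction`). Iterating the resulting halving makes the gradients agree,
hence also the solutions (`IsMildSolution.eqOn`). -/

/-- The space `ℓ²(ℤ²)` of square summable families of Fourier coefficients. -/
abbrev SeqL2 : Type := lp (fun _ : Fin 2 → ℤ => ℂ) 2

/-- The real space `L¹(𝕋²)`. -/
abbrev L1 : Type := Lp ℝ 1 dx

/-- Integrable vector fields on the torus. -/
abbrev FieldL1 : Type := Lp Plane 1 dx

/-- Square integrable vector fields on the torus. -/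
abbrev FieldL2 : Type := Lp Plane 2 dx

/-! ### Fourier coefficients of integrable functions -/

lemma fourierCoeff_eq_integral (f : Torus → ℝ) (k : Fin 2 → ℤ) :
    fourierCoeff f k = ∫ x, UnitAddTorus.mFourier (-k) x * (f x : ℂ) ∂dx := rfl

lemma norm_mFourier_apply (k : Fin 2 → ℤ) (x : Torus) : ‖UnitAddTorus.mFourier k x‖ = 1 := by
  simp only [UnitAddTorus.mFourier, ContinuousMap.coe_mk, fourier_apply, norm_prod,
    Circle.norm_coe, Finset.prod_const_one]

lemma integrable_continuous_mul (φ : C(Torus, ℂ)) {f : Torus → ℝ} (hf : Integrable f dx) :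
    Integrable (fun x => φ x * (f x : ℂ)) dx :=
  hf.ofReal.bdd_mul (c := ‖φ‖) φ.continuous.aestronglyMeasurable
    (ae_of_all _ fun x => φ.norm_coe_le_norm x)

lemma fourierCoeff_congr_ae {f g : Torus → ℝ} (h : f =ᵐ[dx] g) (k : Fin 2 → ℤ) :
    fourierCoeff f k = fourierCoeff g k := by
  rw [fourierCoeff_eq_integral, fourierCoeff_eq_integral]
  refine integral_congr_ae ?_
  filter_upwards [h] with x hx
  rw [hx]

lemma fourierCoeff_add {f g : Torus → ℝ} (hf : Integrable f dx) (hg : Integrable g dx)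
    (k : Fin 2 → ℤ) :
    fourierCoeff (fun x => f x + g x) k = fourierCoeff f k + fourierCoeff g k := by
  simp only [fourierCoeff_eq_integral, Complex.ofReal_add, mul_add]
  exact integral_add (integrable_continuous_mul _ hf) (integrable_continuous_mul _ hg)

lemma fourierCoeff_sub {f g : Torus → ℝ} (hf : Integrable f dx) (hg : Integrable g dx)
    (k : Fin 2 → ℤ) :
    fourierCoeff (fun x => f x - g x) k = fourierCoeff f k - fourierCoeff g k := by
  simp only [fourierCoeff_eq_integral, Complex.ofReal_sub, mul_sub]
  exact integral_sub (integrable_continuous_mul _ hf) (integrable_continuous_mul _ hg)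

lemma fourierCoeff_const_mul (c : ℝ) (f : Torus → ℝ) (k : Fin 2 → ℤ) :
    fourierCoeff (fun x => c * f x) k = c * fourierCoeff f k := by
  simp only [fourierCoeff_eq_integral, Complex.ofReal_mul]
  rw [← integral_const_mul]
  congr 1 with x
  ring

lemma norm_fourierCoeff_le (f : Torus → ℝ) (k : Fin 2 → ℤ) :
    ‖fourierCoeff f k‖ ≤ ∫ x, ‖f x‖ ∂dx := by
  rw [fourierCoeff_eq_integral]
  refine (norm_integral_le_integral_norm _).trans_eq ?_
  simp [norm_mFourier_apply]

lemma fourierCoeff_neg (f : Torus → ℝ) (k : Fin 2 → ℤ) :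
    fourierCoeff f (-k) = conj (fourierCoeff f k) := by
  rw [fourierCoeff_eq_integral, fourierCoeff_eq_integral, ← integral_conj]
  simp [UnitAddTorus.mFourier_neg]

/-- An integrable function all of whose Fourier coefficients vanish is orthogonal to all continuous
functions. -/
lemma integral_continuous_mul_eq_zero {f : Torus → ℝ} (hf : Integrable f dx)
    (h : ∀ k, fourierCoeff f k = 0) (φ : C(Torus, ℂ)) : ∫ x, φ x * (f x : ℂ) ∂dx = 0 := by
  let L : C(Torus, ℂ) →L[ℂ] ℂ := LinearMap.mkContinuous
    { toFun := fun φ => ∫ x, φ x * (f x : ℂ) ∂dx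
      map_add' := fun φ ψ => by
        simp only [ContinuousMap.add_apply, add_mul]
        exact integral_add (integrable_continuous_mul _ hf) (integrable_continuous_mul _ hf)
      map_smul' := fun c φ => by
        simp only [ContinuousMap.smul_apply, smul_eq_mul, mul_assoc, RingHom.id_apply]
        exact integral_const_mul _ _ } (∫ x, ‖f x‖ ∂dx) (fun φ => by
        refine (norm_integral_le_integral_norm _).trans ?_
        rw [← integral_mul_const]
        refine integral_mono (integrable_continuous_mul _ hf).norm (hf.norm.mul_const _) fun x => ?_
        simp only [norm_mul, Complex.norm_real]
        rw [mul_comm]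
        exact mul_le_mul_of_nonneg_left (φ.norm_coe_le_norm x) (norm_nonneg _))
  have hL : L = 0 := by
    refine ContinuousLinearMap.ext_on
      (s := range (UnitAddTorus.mFourier (d := Fin 2))) ?_ ?_
    · rw [Submodule.dense_iff_topologicalClosure_eq_top]
      exact UnitAddTorus.span_mFourier_closure_eq_top
    · rintro _ ⟨k, rfl⟩
      have := h (-k)
      rw [fourierCoeff_eq_integral, neg_neg] at this
      exact this
  exact congrArg (fun M : C(Torus, ℂ) →L[ℂ] ℂ => M φ) hL

/-- Indicators of closed sets are bounded pointwise limits of continuous functions, so orthogonality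
to continuous functions passes to closed sets, whose integrals determine an integrable function. -/
lemma ae_eq_zero_of_fourierCoeff_eq_zero {f : Torus → ℝ} (hf : Integrable f dx)
    (h : ∀ k, fourierCoeff f k = 0) : f =ᵐ[dx] 0 := by
  refine ae_eq_zero_of_forall_setIntegral_isClosed_eq_zero hf fun s hs => ?_
  have hφ : ∀ n, ∫ x, (hs.apprSeq n x : ℝ) * f x ∂dx = 0 := fun n => by
    have := integral_continuous_mul_eq_zero hf h
      ⟨fun x => ((hs.apprSeq n x : ℝ) : ℂ), by fun_prop⟩
    simp only [ContinuousMap.coe_mk, ← Complex.ofReal_mul] at this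
    rw [integral_complex_ofReal] at this
    exact_mod_cast this
  have hlim : Tendsto (fun n => ∫ x, (hs.apprSeq n x : ℝ) * f x ∂dx) atTop
      (𝓝 (∫ x, s.indicator f x ∂dx)) := by
    refine tendsto_integral_of_dominated_convergence (fun x => ‖f x‖) (fun n => ?_) hf.norm
      (fun n => ae_of_all _ fun x => ?_) (ae_of_all _ fun x => ?_)
    · refine AEStronglyMeasurable.mul ?_ hf.aestronglyMeasurable
      exact Continuous.aestronglyMeasurable (by fun_prop)
    · rw [norm_mul]
      refine mul_le_of_le_one_left (norm_nonneg _) ?_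
      simpa using HasOuterApproxClosed.apprSeq_apply_le_one hs n x
    · have h1 := (tendsto_pi_nhds.1 (HasOuterApproxClosed.tendsto_apprSeq hs)) x
      have h2 := ((NNReal.tendsto_coe.2 h1).mul_const (f x))
      convert h2 using 2
      by_cases hx : x ∈ s <;> simp [hx]
  rw [integral_indicator hs.measurableSet] at hlim
  simp only [hφ] at hlim
  exact tendsto_nhds_unique hlim tendsto_const_nhds

lemma ae_eq_of_fourierCoeff_eq {f g : Torus → ℝ} (hf : Integrable f dx) (hg : Integrable g dx)
    (h : ∀ k, fourierCoeff f k = fourierCoeff g k) : f =ᵐ[dx] g := by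
  have := ae_eq_zero_of_fourierCoeff_eq_zero (f := fun x => f x - g x) (hf.sub hg) fun k => by
    rw [fourierCoeff_sub hf hg, h, sub_self]
  filter_upwards [this] with x hx
  exact sub_eq_zero.1 hx

lemma L2_integrable (f : L2) : Integrable f dx := (Lp.memLp f).integrable one_le_two

lemma L2_ext {f g : L2} (h : ∀ k, fourierCoeff f k = fourierCoeff g k) : f = g :=
  Lp.ext (ae_eq_of_fourierCoeff_eq (L2_integrable f) (L2_integrable g) h)

lemma L1_integrable (f : L1) : Integrable f dx := L1.integrable_coeFn f

/-! ### Synthesis and analysis of square integrable functions -/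

/-- The real part of the Fourier series with coefficients `c`. -/
def synth : SeqL2 →L[ℝ] L2 :=
  (Complex.reCLM.compLpL 2 dx).comp
    ((UnitAddTorus.mFourierBasis (d := Fin 2)).repr.symm.toContinuousLinearEquiv
      |>.toContinuousLinearMap.restrictScalars ℝ)

lemma synth_ae (c : SeqL2) :
    synth c =ᵐ[dx] fun x => ((UnitAddTorus.mFourierBasis (d := Fin 2)).repr.symm c x).re :=
  Complex.reCLM.coeFn_compLpL _

lemma norm_synth_le (c : SeqL2) : ‖synth c‖ ≤ ‖c‖ := by
  refine (Complex.reCLM.norm_compLp_le _).trans ?_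
  rw [Complex.reCLM_norm, one_mul]
  exact ((UnitAddTorus.mFourierBasis (d := Fin 2)).repr.symm.norm_map c).le

/-- Conjugate symmetry makes `conj g` have the same coefficients as `g`, so the real part taken by
`synth` loses nothing. -/
lemma fourierCoeff_synth {c : SeqL2} (hc : ∀ k, c (-k) = conj (c k)) (k : Fin 2 → ℤ) :
    fourierCoeff (synth c) k = c k := by
  set g := (UnitAddTorus.mFourierBasis (d := Fin 2)).repr.symm c with hg
  have hgc : ∀ k, ∫ x, UnitAddTorus.mFourier (-k) x * g x ∂dx = c k := fun k => by
    have := UnitAddTorus.mFourierBasis_repr g k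
    rw [hg, LinearIsometryEquiv.apply_symm_apply] at this
    exact this.symm
  have hgi : Integrable g dx := MemLp.integrable (μ := dx) one_le_two (Lp.memLp g)
  have hint : ∀ k, Integrable (fun x => UnitAddTorus.mFourier k x * g x) dx := fun k =>
    hgi.bdd_mul (c := 1) (UnitAddTorus.mFourier k).continuous.aestronglyMeasurable
      (ae_of_all _ fun x => (norm_mFourier_apply k x).le)
  have hconj : ∫ x, UnitAddTorus.mFourier (-k) x * conj (g x) ∂dx = c k := by
    have := congrArg conj (hgc (-k))
    rw [← integral_conj, hc, Complex.conj_conj] at this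
    rw [← this]
    simp [UnitAddTorus.mFourier_neg]
  have hint' : Integrable (fun x => UnitAddTorus.mFourier (-k) x * conj (g x)) dx := by
    refine Integrable.bdd_mul (c := 1) ?_
      (UnitAddTorus.mFourier (-k)).continuous.aestronglyMeasurable
      (ae_of_all _ fun x => (norm_mFourier_apply (-k) x).le)
    exact Complex.conjCLE.toContinuousLinearMap.integrable_comp hgi
  rw [fourierCoeff_congr_ae (synth_ae c), fourierCoeff_eq_integral]
  calc ∫ x, UnitAddTorus.mFourier (-k) x * ((g x).re : ℂ) ∂dx
      = ∫ x, (2⁻¹ : ℂ) * (UnitAddTorus.mFourier (-k) x * g x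
          + UnitAddTorus.mFourier (-k) x * conj (g x)) ∂dx := by
        congr 1 with x
        rw [Complex.re_eq_add_conj]
        ring
    _ = c k := by
        rw [integral_const_mul, integral_add (hint _) hint', hgc, hconj]
        ring

/-- The family of Fourier coefficients of a square integrable function. -/
def analysis (f : L2) : SeqL2 :=
  (UnitAddTorus.mFourierBasis (d := Fin 2)).repr (Complex.ofRealCLM.compLp f)

lemma analysis_apply (f : L2) (k : Fin 2 → ℤ) : analysis f k = fourierCoeff f k := by
  rw [analysis, UnitAddTorus.mFourierBasis_repr]
  refine integral_congr_ae ?_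
  filter_upwards [Complex.ofRealCLM.coeFn_compLp f] with x hx
  rw [hx]
  rfl

lemma norm_analysis_le (f : L2) : ‖analysis f‖ ≤ ‖f‖ := by
  rw [analysis, LinearIsometryEquiv.norm_map]
  refine (Complex.ofRealCLM.norm_compLp_le f).trans ?_
  rw [Complex.ofRealCLM_norm, one_mul]

/-- Injectivity of the Fourier transform makes the choice in `invFourier` harmless; `semigroup` and
`divSemigroup` are evaluated through this lemma. -/
lemma invFourier_eq {c : (Fin 2 → ℤ) → ℂ} {f : L2} (h : ∀ k, fourierCoeff f k = c k) :
    invFourier c = f := by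
  have hex : ∃ f : L2, ∀ k, fourierCoeff f k = c k := ⟨f, h⟩
  rw [invFourier, dif_pos hex]
  exact L2_ext fun k => (hex.choose_spec k).trans (h k).symm

/-! ### Multipliers -/

/-- The pointwise product of a square summable family with the Fourier coefficients of an
integrable function. -/
def coeffMul (m : SeqL2) (f : L1) : SeqL2 :=
  ⟨fun k => m k * fourierCoeff f k,
    ((lp.memℓp m).const_mul (‖f‖ : ℂ)).mono' (fun k => by
      rw [norm_mul, norm_mul, mul_comm, Complex.norm_real, norm_norm]
      refine mul_le_mul_of_nonneg_right ?_ (norm_nonneg _)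
      rw [L1.norm_eq_integral_norm]
      exact norm_fourierCoeff_le f k)⟩

lemma coeffMul_apply (m : SeqL2) (f : L1) (k : Fin 2 → ℤ) :
    coeffMul m f k = m k * fourierCoeff f k := rfl

lemma norm_coeffMul_le (m : SeqL2) (f : L1) : ‖coeffMul m f‖ ≤ ‖m‖ * ‖f‖ := by
  have h : ‖coeffMul m f‖ ≤ ‖(‖f‖ : ℂ) • m‖ := by
    refine lp.norm_mono (by simp) fun k => ?_
    rw [coeffMul_apply, lp.coeFn_smul, Pi.smul_apply, smul_eq_mul, norm_mul, norm_mul, mul_comm,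
      Complex.norm_real, norm_norm]
    refine mul_le_mul_of_nonneg_right ?_ (norm_nonneg _)
    rw [L1.norm_eq_integral_norm]
    exact norm_fourierCoeff_le f k
  refine h.trans ?_
  rw [norm_smul, Complex.norm_real, norm_norm, mul_comm]

/-- The Fourier multiplier with a square summable symbol, as an operator from `L¹` to `L²`. -/
def multiplier : SeqL2 →L[ℝ] L1 →L[ℝ] L2 :=
  LinearMap.mkContinuous₂
    (LinearMap.mk₂ ℝ (fun m f => synth (coeffMul m f))
      (fun m m' f => by
        rw [← map_add]; congr 1; ext k
        simp [coeffMul_apply, add_mul])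
      (fun c m f => by
        rw [← map_smul]; congr 1; ext k
        simp [coeffMul_apply, mul_assoc])
      (fun m f f' => by
        rw [← map_add]; congr 1; ext k
        simp only [coeffMul_apply, lp.coeFn_add, Pi.add_apply]
        rw [fourierCoeff_congr_ae (Lp.coeFn_add f f') k, ← mul_add]
        congr 1
        exact fourierCoeff_add (L1_integrable f) (L1_integrable f') k)
      (fun c m f => by
        rw [← map_smul]; congr 1; ext k
        simp only [coeffMul_apply, lp.coeFn_smul, Pi.smul_apply, Complex.real_smul]
        rw [fourierCoeff_congr_ae (Lp.coeFn_smul c f) k, mul_left_comm]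
        congr 1
        exact fourierCoeff_const_mul c f k)) 1
    (fun m f => by
      rw [one_mul]
      exact (norm_synth_le _).trans (norm_coeffMul_le m f))

lemma multiplier_apply (m : SeqL2) (f : L1) : multiplier m f = synth (coeffMul m f) := rfl

lemma norm_multiplier_le (m : SeqL2) : ‖multiplier m‖ ≤ ‖m‖ :=
  ContinuousLinearMap.opNorm_le_bound _ (norm_nonneg _) fun f =>
    (norm_synth_le _).trans (norm_coeffMul_le m f)

lemma fourierCoeff_multiplier {m : SeqL2} (hm : ∀ k, m (-k) = conj (m k)) (f : L1)
    (k : Fin 2 → ℤ) : fourierCoeff (multiplier m f) k = m k * fourierCoeff f k := by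
  rw [multiplier_apply, fourierCoeff_synth, coeffMul_apply]
  intro k
  rw [coeffMul_apply, coeffMul_apply, hm, fourierCoeff_neg, map_mul]

/-- The Fourier coefficient of a square integrable function, as a continuous linear map. -/
def coeffCLM (k : Fin 2 → ℤ) : L2 →L[ℝ] ℂ :=
  LinearMap.mkContinuous
    { toFun := fun f => fourierCoeff f k
      map_add' := fun f g => by
        rw [fourierCoeff_congr_ae (Lp.coeFn_add f g) k]
        exact fourierCoeff_add (L2_integrable f) (L2_integrable g) k
      map_smul' := fun c f => by
        rw [fourierCoeff_congr_ae (Lp.coeFn_smul c f) k]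
        exact fourierCoeff_const_mul c f k } 1 (fun f => by
        rw [one_mul]
        change ‖fourierCoeff f k‖ ≤ ‖f‖
        rw [← analysis_apply]
        exact (lp.norm_apply_le_norm (by simp) _ k).trans (norm_analysis_le f))

@[simp]
lemma coeffCLM_apply (k : Fin 2 → ℤ) (f : L2) : coeffCLM k f = fourierCoeff f k := rfl

/-! ### Square summable families -/

lemma SeqL2_norm_sq (c : SeqL2) : ‖c‖ ^ 2 = ∑' k, ‖c k‖ ^ 2 := by
  have := lp.norm_rpow_eq_tsum (p := 2) (by simp) c
  simpa using this

lemma SeqL2_summable_norm_sq (c : SeqL2) : Summable fun k => ‖c k‖ ^ 2 := by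
  have := (lp.memℓp c).summable (by simp)
  simpa using this

/-- Dominated convergence in `ℓ²`. -/
lemma SeqL2_continuousWithinAt_of_dominated {c : ℝ → SeqL2} {S : Set ℝ} {t₀ : ℝ} (b : SeqL2)
    (hb : ∀ᶠ t in 𝓝[S] t₀, ∀ k, ‖c t k‖ ≤ ‖b k‖) (hb₀ : ∀ k, ‖c t₀ k‖ ≤ ‖b k‖)
    (hc : ∀ k, ContinuousWithinAt (fun t => c t k) S t₀) : ContinuousWithinAt c S t₀ := by
  have hlim : Tendsto (fun t => ∑' k, ‖c t k - c t₀ k‖ ^ 2) (𝓝[S] t₀) (𝓝 (∑' _ : Fin 2 → ℤ, (0 : ℝ))) := by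
    refine tendsto_tsum_of_dominated_convergence (bound := fun k => 4 * ‖b k‖ ^ 2)
      ((SeqL2_summable_norm_sq b).mul_left 4) (fun k => ?_) ?_
    · have h : Tendsto (fun t => ‖c t k - c t₀ k‖ ^ 2) (𝓝[S] t₀) (𝓝 (‖c t₀ k - c t₀ k‖ ^ 2)) :=
        (((hc k).sub tendsto_const_nhds).norm).pow 2
      simpa using h
    · filter_upwards [hb] with t ht k
      rw [Real.norm_of_nonneg (by positivity)]
      have h1 : ‖c t k - c t₀ k‖ ≤ 2 * ‖b k‖ := by
        linarith [norm_sub_le (c t k) (c t₀ k), ht k, hb₀ k]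
      calc ‖c t k - c t₀ k‖ ^ 2 ≤ (2 * ‖b k‖) ^ 2 := by gcongr
        _ = 4 * ‖b k‖ ^ 2 := by ring
  rw [tsum_zero] at hlim
  rw [ContinuousWithinAt, tendsto_iff_norm_sub_tendsto_zero]
  have h2 := hlim.sqrt
  rw [Real.sqrt_zero] at h2
  refine h2.congr fun t => ?_
  have : ∑' k, ‖c t k - c t₀ k‖ ^ 2 = ‖c t - c t₀‖ ^ 2 := by
    rw [SeqL2_norm_sq]
    rfl
  rw [this, Real.sqrt_sq (norm_nonneg _)]

/-! ### The symbol of `∂_j e^{-τΔ²}` -/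

/-- The symbol `(2π|k|)²` of `-Δ`. -/
def laplaceSymbol (k : Fin 2 → ℤ) : ℝ := (2 * Real.pi) ^ 2 * ∑ j, (k j : ℝ) ^ 2

lemma biLaplaceSymbol_eq (k : Fin 2 → ℤ) : biLaplaceSymbol k = laplaceSymbol k ^ 2 := rfl

lemma biLaplaceSymbol_nonneg (k : Fin 2 → ℤ) : 0 ≤ biLaplaceSymbol k := by
  rw [biLaplaceSymbol_eq]; positivity

lemma biLaplaceSymbol_neg (k : Fin 2 → ℤ) : biLaplaceSymbol (-k) = biLaplaceSymbol k := by
  simp [biLaplaceSymbol]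

lemma derivSymbol_neg (k : Fin 2 → ℤ) (j : Fin 2) :
    derivSymbol (-k) j = conj (derivSymbol k j) := by
  have h2 : (starRingEnd ℂ) 2 = 2 := Complex.conj_ofNat 2
  simp [derivSymbol, h2]

/-- Here `‖k‖` is the sup norm on `ℤ²`, the norm in which the lattice sum of `memℓp_norm_rpow` is
taken. -/
lemma norm_sq_le_laplaceSymbol (k : Fin 2 → ℤ) : ‖k‖ ^ 2 ≤ laplaceSymbol k := by
  have hpi : (1 : ℝ) ≤ (2 * Real.pi) ^ 2 := by nlinarith [Real.pi_gt_three]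
  have hsum : ‖k‖ ^ 2 ≤ ∑ j, (k j : ℝ) ^ 2 := by
    have hle : ‖k‖ ≤ √(∑ j, (k j : ℝ) ^ 2) := by
      refine (pi_norm_le_iff_of_nonneg (Real.sqrt_nonneg _)).2 fun j => ?_
      rw [Int.norm_eq_abs, ← Real.sqrt_sq_eq_abs]
      exact Real.sqrt_le_sqrt (Finset.single_le_sum (f := fun j => (k j : ℝ) ^ 2)
        (fun i _ => sq_nonneg _) (Finset.mem_univ j))
    calc ‖k‖ ^ 2 ≤ √(∑ j, (k j : ℝ) ^ 2) ^ 2 := by gcongr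
      _ = _ := Real.sq_sqrt (Finset.sum_nonneg fun i _ => sq_nonneg _)
  rw [laplaceSymbol]
  have h0 : 0 ≤ ∑ j, (k j : ℝ) ^ 2 := Finset.sum_nonneg fun i _ => sq_nonneg _
  nlinarith

lemma norm_derivSymbol_le (k : Fin 2 → ℤ) (j : Fin 2) :
    ‖derivSymbol k j‖ ≤ laplaceSymbol k ^ (1 / 2 : ℝ) := by
  rw [← Real.sqrt_eq_rpow]
  refine Real.le_sqrt_of_sq_le ?_
  have : ‖derivSymbol k j‖ ^ 2 = (2 * Real.pi) ^ 2 * (k j : ℝ) ^ 2 := by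
    simp only [derivSymbol, norm_mul, Complex.norm_I, Complex.norm_intCast, Complex.norm_real,
      Complex.norm_ofNat, mul_one, Real.norm_eq_abs, mul_pow, sq_abs]
  rw [this, laplaceSymbol]
  gcongr
  exact Finset.single_le_sum (f := fun j => (k j : ℝ) ^ 2)
    (fun i _ => sq_nonneg _) (Finset.mem_univ j)

/-- Equivalent to `x^s ≤ max 1 x ≤ e^x`. It is the source of the smoothing estimates and of the gain
from the exponential weight in the uniqueness proof. -/
lemma exp_neg_le_rpow_neg {x s : ℝ} (hx : 0 < x) (hs₀ : 0 ≤ s) (hs₁ : s ≤ 1) :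
    Real.exp (-x) ≤ x ^ (-s) := by
  rw [Real.exp_neg, Real.rpow_neg hx.le]
  refine inv_anti₀ (by positivity) ?_
  rcases le_total x 1 with h | h
  · exact (Real.rpow_le_one hx.le h hs₀).trans (Real.one_le_exp hx.le)
  · calc x ^ s ≤ x ^ (1 : ℝ) := Real.rpow_le_rpow_of_exponent_le h hs₁
      _ = x := Real.rpow_one x
      _ ≤ Real.exp x := by linarith [Real.add_one_le_exp x]

/-- The symbol of `∂_j e^{-τΔ²}`. -/
def heatDerivSymbol (τ : ℝ) (j : Fin 2) (k : Fin 2 → ℤ) : ℂ :=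
  (Real.exp (-τ * biLaplaceSymbol k) : ℂ) * derivSymbol k j

lemma heatDerivSymbol_neg (τ : ℝ) (j : Fin 2) (k : Fin 2 → ℤ) :
    heatDerivSymbol τ j (-k) = conj (heatDerivSymbol τ j k) := by
  rw [heatDerivSymbol, heatDerivSymbol, biLaplaceSymbol_neg, derivSymbol_neg, map_mul,
    Complex.conj_ofReal]

/-- With `Q = (2π|k|)²`, the symbol is at most `e^{-τQ²}Q^{1/2} ≤ τ^{-s}Q^{1/2-2s}`. For `s ≥ 1/4`
the power of `Q` is nonpositive, so `Q` may be replaced by its lower bound `‖k‖²`. The choice `s =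
1/4` gives a bounded multiplier, `s > 1/2` a square summable one. -/
lemma norm_heatDerivSymbol_le {τ s : ℝ} (hτ : 0 < τ) (hs₀ : 1 / 4 ≤ s) (hs₁ : s ≤ 1) (j : Fin 2)
    (k : Fin 2 → ℤ) : ‖heatDerivSymbol τ j k‖ ≤ τ ^ (-s) * ‖k‖ ^ (1 - 4 * s) := by
  -- The zero mode is separate: the derivative kills it, while zero to a negative power is zero by
  -- convention.
  rcases eq_or_ne k 0 with rfl | hk
  · have : heatDerivSymbol τ j 0 = 0 := by simp [heatDerivSymbol, derivSymbol]
    rw [this, norm_zero]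
    positivity
  have hk1 : 0 < ‖k‖ := norm_pos_iff.2 hk
  have hQk := norm_sq_le_laplaceSymbol k
  have hQ : 0 < laplaceSymbol k := lt_of_lt_of_le (by positivity) hQk
  rw [heatDerivSymbol, norm_mul, Complex.norm_real, Real.norm_of_nonneg (Real.exp_nonneg _),
    biLaplaceSymbol_eq]
  calc Real.exp (-τ * laplaceSymbol k ^ 2) * ‖derivSymbol k j‖
      ≤ (τ * laplaceSymbol k ^ 2) ^ (-s) * laplaceSymbol k ^ (1 / 2 : ℝ) := by
        refine mul_le_mul ?_ (norm_derivSymbol_le k j) (norm_nonneg _) (by positivity)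
        rw [neg_mul]
        exact exp_neg_le_rpow_neg (by positivity) (by linarith) hs₁
    _ = τ ^ (-s) * laplaceSymbol k ^ (1 / 2 - 2 * s) := by
        rw [Real.mul_rpow hτ.le (by positivity), mul_assoc, ← Real.rpow_natCast,
          ← Real.rpow_mul hQ.le, ← Real.rpow_add hQ]
        congr 2
        push_cast
        ring
    _ ≤ τ ^ (-s) * (‖k‖ ^ 2) ^ (1 / 2 - 2 * s) := by
        refine mul_le_mul_of_nonneg_left ?_ (by positivity)
        exact Real.rpow_le_rpow_of_nonpos (by positivity) hQk (by linarith)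
    _ = τ ^ (-s) * ‖k‖ ^ (1 - 4 * s) := by
        rw [← Real.rpow_natCast, ← Real.rpow_mul hk1.le]
        congr 2
        push_cast
        ring

/-- The squared weight `‖k‖^{2-8s}` is summable on the two-dimensional lattice when `8s - 2 > 2`.
The strict inequality is what forces the loss `slack` later. -/
lemma memℓp_norm_rpow {s : ℝ} (hs : 1 / 2 < s) :
    Memℓp (fun k : Fin 2 → ℤ => ((‖k‖ ^ (1 - 4 * s) : ℝ) : ℂ)) 2 := by
  refine memℓp_gen ?_
  refine (EisensteinSeries.summable_one_div_norm_rpow (k := 8 * s - 2) (by linarith)).congr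
    fun k => ?_
  rw [Complex.norm_real, Real.norm_of_nonneg (by positivity), ← Real.rpow_mul (norm_nonneg _)]
  congr 1
  simp only [ENNReal.toReal_ofNat]
  ring

/-- The square summable weight `|k|^{1-4s}`, for `s > 1/2`. -/
def normWeight {s : ℝ} (hs : 1 / 2 < s) : SeqL2 := ⟨_, memℓp_norm_rpow hs⟩

lemma normWeight_apply {s : ℝ} (hs : 1 / 2 < s) (k : Fin 2 → ℤ) :
    normWeight hs k = ((‖k‖ ^ (1 - 4 * s) : ℝ) : ℂ) := rfl

lemma norm_heatDerivSymbol_le_weight {τ s : ℝ} (hτ : 0 < τ) (hs : 1 / 2 < s) (hs₁ : s ≤ 1)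
    (j : Fin 2) (k : Fin 2 → ℤ) :
    ‖heatDerivSymbol τ j k‖ ≤ ‖(((τ ^ (-s) : ℝ) : ℂ) • normWeight hs) k‖ := by
  rw [lp.coeFn_smul, Pi.smul_apply, norm_smul, normWeight_apply, Complex.norm_real,
    Complex.norm_real, Real.norm_of_nonneg (by positivity), Real.norm_of_nonneg (by positivity)]
  exact norm_heatDerivSymbol_le hτ (by linarith) hs₁ j k

lemma memℓp_heatDerivSymbol {τ : ℝ} (hτ : 0 < τ) (j : Fin 2) : Memℓp (heatDerivSymbol τ j) 2 :=
  (lp.memℓp (((τ ^ (-(1 : ℝ)) : ℝ) : ℂ) • normWeight (s := 1) (by norm_num))).mono'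
    (norm_heatDerivSymbol_le_weight hτ (by norm_num) le_rfl j)

open Classical in
/-- The symbol of `∂_j e^{-τΔ²}` as a square summable family, for `τ > 0`. -/
def heatDeriv (τ : ℝ) (j : Fin 2) : SeqL2 :=
  if h : 0 < τ then ⟨heatDerivSymbol τ j, memℓp_heatDerivSymbol h j⟩ else 0

lemma heatDeriv_apply {τ : ℝ} (hτ : 0 < τ) (j : Fin 2) (k : Fin 2 → ℤ) :
    heatDeriv τ j k = heatDerivSymbol τ j k := by
  rw [heatDeriv, dif_pos hτ]

lemma heatDeriv_neg {τ : ℝ} (hτ : 0 < τ) (j : Fin 2) (k : Fin 2 → ℤ) :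
    heatDeriv τ j (-k) = conj (heatDeriv τ j k) := by
  rw [heatDeriv_apply hτ, heatDeriv_apply hτ, heatDerivSymbol_neg]

lemma norm_heatDeriv_le {τ s : ℝ} (hτ : 0 < τ) (hs : 1 / 2 < s) (hs₁ : s ≤ 1) (j : Fin 2) :
    ‖heatDeriv τ j‖ ≤ ‖normWeight hs‖ * τ ^ (-s) := by
  have h : ‖heatDeriv τ j‖ ≤ ‖((τ ^ (-s) : ℝ) : ℂ) • normWeight hs‖ := by
    refine lp.norm_mono (by simp) fun k => ?_
    rw [heatDeriv_apply hτ]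
    exact norm_heatDerivSymbol_le_weight hτ hs hs₁ j k
  refine h.trans_eq ?_
  rw [norm_smul, Complex.norm_real, Real.norm_of_nonneg (by positivity), mul_comm]

lemma continuousOn_heatDeriv (j : Fin 2) : ContinuousOn (fun τ => heatDeriv τ j) (Ioi 0) := by
  intro t ht
  have ht' : 0 < t := ht
  -- Near `t` all symbols are dominated by a single square summable weight taken at time `t / 2`.
  have hev : ∀ τ, t / 2 < τ → ∀ k, ‖heatDeriv τ j k‖
      ≤ ‖((((t / 2) ^ (-(1 : ℝ)) : ℝ) : ℂ) • normWeight (s := 1) (by norm_num)) k‖ := by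
    intro τ hτ k
    have hτ0 : 0 < τ := by linarith
    rw [heatDeriv_apply hτ0]
    refine (norm_heatDerivSymbol_le hτ0 (s := 1) (by norm_num) le_rfl j k).trans ?_
    rw [lp.coeFn_smul, Pi.smul_apply, norm_smul, normWeight_apply, Complex.norm_real,
      Complex.norm_real, Real.norm_of_nonneg (by positivity), Real.norm_of_nonneg (by positivity)]
    refine mul_le_mul_of_nonneg_right ?_ (by positivity)
    exact Real.rpow_le_rpow_of_nonpos (by positivity) hτ.le (by norm_num)
  refine SeqL2_continuousWithinAt_of_dominated _ ?_ (hev t (by linarith)) fun k => ?_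
  · exact mem_nhdsWithin_of_mem_nhds ((lt_mem_nhds (by linarith : t / 2 < t)).mono hev)
  · have : ContinuousWithinAt (fun τ => heatDerivSymbol τ j k) (Ioi 0) t := by
      refine Continuous.continuousWithinAt ?_
      unfold heatDerivSymbol
      fun_prop
    exact this.congr (fun τ hτ => heatDeriv_apply hτ j k) (heatDeriv_apply ht j k)

/-! ### Components of vector fields -/

/-- The inclusion of `L²` into `L¹`. -/
def inclL1 (E : Type*) [NormedAddCommGroup E] [NormedSpace ℝ E] : Lp E 2 dx →L[ℝ] Lp E 1 dx :=
  LinearMap.mkContinuous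
    { toFun := fun f => ((Lp.memLp f).mono_exponent one_le_two).toLp f
      map_add' := fun f g => by
        ext1
        filter_upwards [MemLp.coeFn_toLp ((Lp.memLp (f + g)).mono_exponent one_le_two),
          Lp.coeFn_add f g, MemLp.coeFn_toLp ((Lp.memLp f).mono_exponent one_le_two),
          MemLp.coeFn_toLp ((Lp.memLp g).mono_exponent one_le_two),
          Lp.coeFn_add (((Lp.memLp f).mono_exponent one_le_two).toLp f)
            (((Lp.memLp g).mono_exponent one_le_two).toLp g)] with x h1 h2 h3 h4 h5
        rw [h1, h2, h5, Pi.add_apply, Pi.add_apply, h3, h4]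
      map_smul' := fun c f => by
        ext1
        filter_upwards [MemLp.coeFn_toLp ((Lp.memLp (c • f)).mono_exponent one_le_two),
          Lp.coeFn_smul c f, MemLp.coeFn_toLp ((Lp.memLp f).mono_exponent one_le_two),
          Lp.coeFn_smul c (((Lp.memLp f).mono_exponent one_le_two).toLp f)] with x h1 h2 h3 h4
        rw [h1, h2, RingHom.id_apply, h4, Pi.smul_apply, Pi.smul_apply, h3] } 1 (fun f => by
    rw [one_mul]
    change ‖((Lp.memLp f).mono_exponent one_le_two).toLp f‖ ≤ ‖f‖
    rw [Lp.norm_toLp, Lp.norm_def]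
    exact ENNReal.toReal_mono (Lp.memLp f).eLpNorm_ne_top
      (eLpNorm_le_eLpNorm_of_exponent_le one_le_two (Lp.memLp f).aestronglyMeasurable))

lemma inclL1_ae {E : Type*} [NormedAddCommGroup E] [NormedSpace ℝ E] (f : Lp E 2 dx) :
    inclL1 E f =ᵐ[dx] f :=
  MemLp.coeFn_toLp ((Lp.memLp f).mono_exponent one_le_two)

lemma norm_inclL1_le {E : Type*} [NormedAddCommGroup E] [NormedSpace ℝ E] (f : Lp E 2 dx) :
    ‖inclL1 E f‖ ≤ ‖f‖ := by
  simpa using (inclL1 E).le_of_opNorm_le (LinearMap.mkContinuous_norm_le _ zero_le_one _) f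

/-- The `j`-th component of a vector field. -/
def component (r : ℝ≥0∞) [Fact (1 ≤ r)] (j : Fin 2) : Lp Plane r dx →L[ℝ] Lp ℝ r dx :=
  (EuclideanSpace.proj (𝕜 := ℝ) j).compLpL r dx

lemma component_ae {r : ℝ≥0∞} [Fact (1 ≤ r)] (j : Fin 2) (h : Lp Plane r dx) :
    component r j h =ᵐ[dx] fun x => h x j :=
  (EuclideanSpace.proj (𝕜 := ℝ) j).coeFn_compLpL h

lemma norm_component_le {r : ℝ≥0∞} [Fact (1 ≤ r)] (j : Fin 2) (h : Lp Plane r dx) :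
    ‖component r j h‖ ≤ ‖h‖ := by
  refine ((EuclideanSpace.proj (𝕜 := ℝ) j).norm_compLp_le h).trans ?_
  refine mul_le_of_le_one_left (norm_nonneg _) ?_
  refine ContinuousLinearMap.opNorm_le_bound _ zero_le_one fun x => ?_
  rw [one_mul]
  exact PiLp.norm_apply_le x j

/-- The vector field `f e_j`. -/
def alongAxis (j : Fin 2) : L2 →L[ℝ] FieldL2 :=
  (ContinuousLinearMap.toSpanSingleton ℝ (EuclideanSpace.single j (1 : ℝ))).compLpL 2 dx

lemma alongAxis_ae (j : Fin 2) (f : L2) :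
    alongAxis j f =ᵐ[dx] fun x => f x • EuclideanSpace.single j (1 : ℝ) :=
  (ContinuousLinearMap.toSpanSingleton ℝ (EuclideanSpace.single j (1 : ℝ))).coeFn_compLpL f

lemma norm_alongAxis_le (j : Fin 2) (f : L2) : ‖alongAxis j f‖ ≤ ‖f‖ := by
  refine ((ContinuousLinearMap.toSpanSingleton ℝ
    (EuclideanSpace.single j (1 : ℝ))).norm_compLp_le f).trans ?_
  simp

lemma component_alongAxis (i j : Fin 2) (f : L2) :
    component 2 i (alongAxis j f) = if i = j then f else 0 := by
  ext1
  filter_upwards [component_ae i (alongAxis j f), alongAxis_ae j f] with x h1 h2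
  rw [h1, h2]
  split_ifs with h
  · simp [h]
  · simp [h]

lemma FieldL2_ext {g h : FieldL2} (H : ∀ j, component 2 j g = component 2 j h) : g = h := by
  ext1
  have h1 : ∀ j, (fun x => g x j) =ᵐ[dx] fun x => h x j := fun j =>
    (component_ae j g).symm.trans ((EventuallyEq.of_eq
      (congrArg (fun f : L2 => (f : Torus → ℝ)) (H j))).trans (component_ae j h))
  filter_upwards [h1 0, h1 1] with x h0 h1
  ext j
  fin_cases j
  · exact h0
  · exact h1

lemma sum_alongAxis_component (g : FieldL2) : ∑ j, alongAxis j (component 2 j g) = g := by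
  refine FieldL2_ext fun i => ?_
  simp only [map_sum, component_alongAxis, Finset.sum_ite_eq, Finset.mem_univ, if_true]

/-! ### The operators `∇ e^{-τΔ²}` and `∇ · e^{-τΔ²}` -/

/-- The operator `∇ e^{-τΔ²}` on `L²`, for `τ > 0`. -/
def gradHeat (τ : ℝ) : L2 →L[ℝ] FieldL2 :=
  ∑ j, (alongAxis j).comp ((multiplier (heatDeriv τ j)).comp (inclL1 ℝ))

/-- The operator `∇ · e^{-τΔ²}` from `L¹` to `L²`, for `τ > 0`. -/
def divHeat (τ : ℝ) : FieldL1 →L[ℝ] L2 :=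
  ∑ j, (multiplier (heatDeriv τ j)).comp (component 1 j)

lemma gradHeat_apply (τ : ℝ) (f : L2) :
    gradHeat τ f = ∑ j, alongAxis j (multiplier (heatDeriv τ j) (inclL1 ℝ f)) := by
  simp [gradHeat]

lemma divHeat_apply (τ : ℝ) (h : FieldL1) :
    divHeat τ h = ∑ j, multiplier (heatDeriv τ j) (component 1 j h) := by
  simp [divHeat]

lemma component_gradHeat (τ : ℝ) (f : L2) (i : Fin 2) :
    component 2 i (gradHeat τ f) = multiplier (heatDeriv τ i) (inclL1 ℝ f) := by
  simp only [gradHeat_apply, map_sum, component_alongAxis, Finset.sum_ite_eq, Finset.mem_univ,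
    if_true]

lemma fourierCoeff_component_gradHeat {τ : ℝ} (hτ : 0 < τ) (f : L2) (i : Fin 2)
    (k : Fin 2 → ℤ) :
    fourierCoeff (component 2 i (gradHeat τ f)) k = heatDerivSymbol τ i k * fourierCoeff f k := by
  rw [component_gradHeat, fourierCoeff_multiplier (heatDeriv_neg hτ i), heatDeriv_apply hτ,
    fourierCoeff_congr_ae (inclL1_ae f)]

lemma fourierCoeff_divHeat {τ : ℝ} (hτ : 0 < τ) (h : FieldL1) (k : Fin 2 → ℤ) :
    fourierCoeff (divHeat τ h) k
      = ∑ j, heatDerivSymbol τ j k * fourierCoeff (fun x => h x j) k := by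
  rw [divHeat_apply, ← coeffCLM_apply, map_sum]
  refine Finset.sum_congr rfl fun j _ => ?_
  rw [coeffCLM_apply, fourierCoeff_multiplier (heatDeriv_neg hτ j), heatDeriv_apply hτ,
    fourierCoeff_congr_ae (component_ae j h)]

/-- Passes from the operator defined by choice to a bounded operator, to which norm estimates and
Bochner integration apply. -/
lemma divSemigroup_eq_divHeat {τ : ℝ} (hτ : 0 < τ) {H : Torus → Plane} {h : FieldL1}
    (hH : H =ᵐ[dx] h) : divSemigroup τ H = divHeat τ h := by
  refine invFourier_eq fun k => ?_
  rw [fourierCoeff_divHeat hτ, Finset.mul_sum]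
  refine Finset.sum_congr rfl fun j _ => ?_
  rw [heatDerivSymbol, mul_assoc]
  congr 2
  refine fourierCoeff_congr_ae ?_ k
  filter_upwards [hH] with x hx
  rw [hx]

lemma norm_divHeat_le {τ s : ℝ} (hτ : 0 < τ) (hs : 1 / 2 < s) (hs₁ : s ≤ 1) :
    ‖divHeat τ‖ ≤ 2 * ‖normWeight hs‖ * τ ^ (-s) := by
  refine ContinuousLinearMap.opNorm_le_bound _ (by positivity) fun h => ?_
  rw [divHeat_apply]
  refine (norm_sum_le _ _).trans ?_
  have hj : ∀ j, ‖multiplier (heatDeriv τ j) (component 1 j h)‖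
      ≤ ‖normWeight hs‖ * τ ^ (-s) * ‖h‖ := fun j =>
    ((multiplier _).le_of_opNorm_le
      ((norm_multiplier_le _).trans (norm_heatDeriv_le hτ hs hs₁ j)) _).trans
      (mul_le_mul_of_nonneg_left (norm_component_le j h) (by positivity))
  refine (Finset.sum_le_sum fun j _ => hj j).trans_eq ?_
  simp only [Finset.sum_const, Finset.card_univ, Fintype.card_fin, nsmul_eq_mul]
  push_cast
  ring

lemma norm_gradHeat_le {τ : ℝ} (hτ : 0 < τ) : ‖gradHeat τ‖ ≤ 2 * τ ^ (-(1 / 4) : ℝ) := by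
  refine ContinuousLinearMap.opNorm_le_bound _ (by positivity) fun f => ?_
  rw [gradHeat_apply]
  refine (norm_sum_le _ _).trans ?_
  have hj : ∀ j, ‖alongAxis j (multiplier (heatDeriv τ j) (inclL1 ℝ f))‖
      ≤ τ ^ (-(1 / 4) : ℝ) * ‖f‖ := fun j => by
    refine (norm_alongAxis_le _ _).trans ?_
    rw [multiplier_apply]
    refine (norm_synth_le _).trans ?_
    have h : ‖coeffMul (heatDeriv τ j) (inclL1 ℝ f)‖
        ≤ ‖((τ ^ (-(1 / 4) : ℝ) : ℝ) : ℂ) • analysis f‖ := by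
      refine lp.norm_mono (by simp) fun k => ?_
      rw [coeffMul_apply, heatDeriv_apply hτ, lp.coeFn_smul, Pi.smul_apply, norm_smul,
        analysis_apply, norm_mul, Complex.norm_real, Real.norm_of_nonneg (by positivity),
        fourierCoeff_congr_ae (inclL1_ae f)]
      refine mul_le_mul_of_nonneg_right ?_ (norm_nonneg _)
      simpa using norm_heatDerivSymbol_le hτ (s := 1 / 4) le_rfl (by norm_num) j k
    refine h.trans ?_
    rw [norm_smul, Complex.norm_real, Real.norm_of_nonneg (by positivity)]
    exact mul_le_mul_of_nonneg_left (norm_analysis_le f) (by positivity)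
  refine (Finset.sum_le_sum fun j _ => hj j).trans_eq ?_
  simp only [Finset.sum_const, Finset.card_univ, Fintype.card_fin, nsmul_eq_mul]
  push_cast
  ring

lemma continuousOn_gradHeat : ContinuousOn gradHeat (Ioi 0) := by
  unfold gradHeat
  refine continuousOn_finsetSum _ fun j _ => ?_
  exact continuousOn_const.clm_comp
    ((multiplier.continuous.comp_continuousOn (continuousOn_heatDeriv j)).clm_comp
      continuousOn_const)

lemma continuousOn_divHeat : ContinuousOn divHeat (Ioi 0) := by
  unfold divHeat
  refine continuousOn_finsetSum _ fun j _ => ?_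
  exact (multiplier.continuous.comp_continuousOn (continuousOn_heatDeriv j)).clm_comp
      continuousOn_const

/-- The operator `∇ ∇ · e^{-τΔ²}` from `L¹` to `L²`, for `τ > 0`. -/
def gradDivHeat (τ : ℝ) : FieldL1 →L[ℝ] FieldL2 := (gradHeat (τ / 2)).comp (divHeat (τ / 2))

/-- The semigroup law: the exponentials multiply, so only the total time matters. -/
lemma gradHeat_divHeat {σ τ σ' τ' : ℝ} (hσ : 0 < σ) (hτ : 0 < τ) (hσ' : 0 < σ') (hτ' : 0 < τ')
    (h : σ + τ = σ' + τ') (H : FieldL1) :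
    gradHeat σ (divHeat τ H) = gradHeat σ' (divHeat τ' H) := by
  refine FieldL2_ext fun i => L2_ext fun k => ?_
  rw [fourierCoeff_component_gradHeat hσ, fourierCoeff_component_gradHeat hσ',
    fourierCoeff_divHeat hτ, fourierCoeff_divHeat hτ', Finset.mul_sum, Finset.mul_sum]
  refine Finset.sum_congr rfl fun j _ => ?_
  have hexp : (Real.exp (-σ * biLaplaceSymbol k) : ℂ) * (Real.exp (-τ * biLaplaceSymbol k) : ℂ)
      = (Real.exp (-σ' * biLaplaceSymbol k) : ℂ) * (Real.exp (-τ' * biLaplaceSymbol k) : ℂ) := by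
    rw [← Complex.ofReal_mul, ← Complex.ofReal_mul, ← Real.exp_add, ← Real.exp_add, ← add_mul,
      ← add_mul, ← neg_add, ← neg_add, h]
  simp only [heatDerivSymbol]
  linear_combination (derivSymbol k i * derivSymbol k j * fourierCoeff (fun x => H x j) k) * hexp

lemma gradHeat_divHeat_eq {σ τ : ℝ} (hσ : 0 < σ) (hτ : 0 < τ) (H : FieldL1) :
    gradHeat σ (divHeat τ H) = gradDivHeat (σ + τ) H :=
  gradHeat_divHeat hσ hτ (by positivity) (by positivity) (by ring) H

lemma fourierCoeff_component_gradDivHeat {τ : ℝ} (hτ : 0 < τ) (H : FieldL1) (i : Fin 2)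
    (k : Fin 2 → ℤ) :
    fourierCoeff (component 2 i (gradDivHeat τ H)) k
      = derivSymbol k i * fourierCoeff (divHeat τ H) k := by
  rw [gradDivHeat, ContinuousLinearMap.comp_apply, fourierCoeff_component_gradHeat (by positivity),
    fourierCoeff_divHeat (by positivity), fourierCoeff_divHeat hτ, Finset.mul_sum, Finset.mul_sum]
  refine Finset.sum_congr rfl fun j _ => ?_
  have hexp : (Real.exp (-(τ / 2) * biLaplaceSymbol k) : ℂ)
      * (Real.exp (-(τ / 2) * biLaplaceSymbol k) : ℂ)
      = (Real.exp (-τ * biLaplaceSymbol k) : ℂ) := by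
    rw [← Complex.ofReal_mul, ← Real.exp_add]
    congr 2
    ring
  simp only [heatDerivSymbol]
  linear_combination (derivSymbol k i * derivSymbol k j * fourierCoeff (fun x => H x j) k) * hexp

lemma continuousOn_gradDivHeat : ContinuousOn gradDivHeat (Ioi 0) := by
  have hhalf : ContinuousOn (fun τ : ℝ => τ / 2) (Ioi 0) := by fun_prop
  have hmap : MapsTo (fun τ : ℝ => τ / 2) (Ioi 0) (Ioi 0) :=
    fun τ hτ => mem_Ioi.2 (half_pos (mem_Ioi.1 hτ))
  exact (continuousOn_gradHeat.comp hhalf hmap).clm_comp (continuousOn_divHeat.comp hhalf hmap)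

/-- Half of the time pays for each derivative, so the two exponents add; halving costs at most
`2^{s+1/4} ≤ 4`. -/
lemma norm_gradDivHeat_le {τ s : ℝ} (hτ : 0 < τ) (hs : 1 / 2 < s) (hs₁ : s ≤ 1) :
    ‖gradDivHeat τ‖ ≤ 16 * ‖normWeight hs‖ * τ ^ (-(s + 1 / 4)) := by
  refine (ContinuousLinearMap.opNorm_comp_le _ _).trans ?_
  have hpow : (2 : ℝ) ^ (s + 1 / 4) ≤ 4 := by
    calc (2 : ℝ) ^ (s + 1 / 4) ≤ 2 ^ (2 : ℝ) :=
          Real.rpow_le_rpow_of_exponent_le one_le_two (by linarith)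
      _ = 4 := by norm_num
  calc ‖gradHeat (τ / 2)‖ * ‖divHeat (τ / 2)‖
      ≤ (2 * (τ / 2) ^ (-(1 / 4) : ℝ)) * (2 * ‖normWeight hs‖ * (τ / 2) ^ (-s)) :=
        mul_le_mul (norm_gradHeat_le (by positivity)) (norm_divHeat_le (by positivity) hs hs₁)
          (norm_nonneg _) (by positivity)
    _ = 4 * ‖normWeight hs‖ * (τ / 2) ^ (-(s + 1 / 4)) := by
        rw [neg_add, Real.rpow_add (by positivity)]
        ring
    _ = 4 * ‖normWeight hs‖ * (2 ^ (s + 1 / 4) * τ ^ (-(s + 1 / 4))) := by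
        rw [Real.div_rpow hτ.le (by norm_num), Real.rpow_neg zero_le_two, div_inv_eq_mul, mul_comm
          (τ ^ _)]
    _ ≤ 4 * ‖normWeight hs‖ * (4 * τ ^ (-(s + 1 / 4))) := by gcongr
    _ = 16 * ‖normWeight hs‖ * τ ^ (-(s + 1 / 4)) := by ring

/-! ### The semigroup -/

lemma norm_exp_neg_mul_le_one {t : ℝ} (ht : 0 ≤ t) (k : Fin 2 → ℤ) :
    ‖(Real.exp (-t * biLaplaceSymbol k) : ℂ)‖ ≤ 1 := by
  rw [Complex.norm_real, Real.norm_of_nonneg (Real.exp_nonneg _)]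
  refine Real.exp_le_one_iff.2 ?_
  have := mul_nonneg ht (biLaplaceSymbol_nonneg k)
  linarith

open Classical in
/-- The family of Fourier coefficients of `e^{-tΔ²} f`, for `t ≥ 0`. -/
def heatFamily (f : L2) (t : ℝ) : SeqL2 :=
  if ht : 0 ≤ t then
    ⟨fun k => (Real.exp (-t * biLaplaceSymbol k) : ℂ) * analysis f k,
      (lp.memℓp (analysis f)).mono' fun k => by
        rw [norm_mul]
        exact mul_le_of_le_one_left (norm_nonneg _) (norm_exp_neg_mul_le_one ht k)⟩
  else 0

lemma heatFamily_apply (f : L2) {t : ℝ} (ht : 0 ≤ t) (k : Fin 2 → ℤ) :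
    heatFamily f t k = (Real.exp (-t * biLaplaceSymbol k) : ℂ) * fourierCoeff f k := by
  rw [heatFamily, dif_pos ht, ← analysis_apply]

lemma fourierCoeff_synth_heatFamily (f : L2) {t : ℝ} (ht : 0 ≤ t) (k : Fin 2 → ℤ) :
    fourierCoeff (synth (heatFamily f t)) k
      = (Real.exp (-t * biLaplaceSymbol k) : ℂ) * fourierCoeff f k := by
  rw [fourierCoeff_synth, heatFamily_apply f ht]
  intro k
  rw [heatFamily_apply f ht, heatFamily_apply f ht, biLaplaceSymbol_neg, fourierCoeff_neg, map_mul,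
    Complex.conj_ofReal]

lemma semigroup_eq_synth (f : L2) {t : ℝ} (ht : 0 ≤ t) :
    semigroup t f = synth (heatFamily f t) :=
  invFourier_eq (fourierCoeff_synth_heatFamily f ht)

lemma fourierCoeff_semigroup (f : L2) {t : ℝ} (ht : 0 ≤ t) (k : Fin 2 → ℤ) :
    fourierCoeff (semigroup t f) k
      = (Real.exp (-t * biLaplaceSymbol k) : ℂ) * fourierCoeff f k := by
  rw [semigroup_eq_synth f ht, fourierCoeff_synth_heatFamily f ht]

lemma semigroup_zero (f : L2) : semigroup 0 f = f :=
  invFourier_eq fun k => by simp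

lemma continuousOn_semigroup (f : L2) : ContinuousOn (fun t => semigroup t f) (Ici 0) := by
  have h : ContinuousOn (heatFamily f) (Ici 0) := by
    intro t ht
    have hb : ∀ τ ∈ Ici (0 : ℝ), ∀ k, ‖heatFamily f τ k‖ ≤ ‖analysis f k‖ := fun τ hτ k => by
      rw [heatFamily_apply f hτ, analysis_apply, norm_mul]
      exact mul_le_of_le_one_left (norm_nonneg _) (norm_exp_neg_mul_le_one hτ k)
    refine SeqL2_continuousWithinAt_of_dominated (analysis f)
      (eventually_mem_nhdsWithin.mono hb) (hb t ht) fun k => ?_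
    have hc : ContinuousWithinAt
        (fun τ => (Real.exp (-τ * biLaplaceSymbol k) : ℂ) * fourierCoeff f k) (Ici 0) t :=
      Continuous.continuousWithinAt (by fun_prop)
    exact hc.congr (fun τ hτ => heatFamily_apply f hτ k) (heatFamily_apply f ht k)
  exact (synth.continuous.comp_continuousOn h).congr fun t ht => semigroup_eq_synth f ht

/-! ### Weak gradients -/

lemma isWeakGradient_iff (f : L2) (g : FieldL2) :
    IsWeakGradient f g ↔ ∀ (k : Fin 2 → ℤ) (j : Fin 2),
      fourierCoeff (component 2 j g) k = derivSymbol k j * fourierCoeff f k := by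
  rw [IsWeakGradient, and_iff_right (L2_integrable f),
    and_iff_right ((Lp.memLp g).integrable one_le_two)]
  refine forall_congr' fun k => forall_congr' fun j => ?_
  rw [fourierCoeff_congr_ae (component_ae j g)]

lemma IsWeakGradient.congr_ae {f : Torus → ℝ} {g h : Torus → Plane} (hg : IsWeakGradient f g)
    (hgh : g =ᵐ[dx] h) : IsWeakGradient f h := by
  refine ⟨hg.1, hg.2.1.congr hgh, fun k j => ?_⟩
  rw [← hg.2.2 k j]
  refine fourierCoeff_congr_ae ?_ k
  filter_upwards [hgh] with x hx
  rw [hx]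

lemma integrable_field_apply {g : Torus → Plane} (hg : Integrable g dx) (j : Fin 2) :
    Integrable (fun x => g x j) dx :=
  (EuclideanSpace.proj (𝕜 := ℝ) j).integrable_comp hg

lemma IsWeakGradient.ae_unique {f : Torus → ℝ} {g h : Torus → Plane} (hg : IsWeakGradient f g)
    (hh : IsWeakGradient f h) : g =ᵐ[dx] h := by
  have h1 : ∀ j, (fun x => g x j) =ᵐ[dx] fun x => h x j := fun j =>
    ae_eq_of_fourierCoeff_eq (integrable_field_apply hg.2.1 j) (integrable_field_apply hh.2.1 j)
      fun k => (hg.2.2 k j).trans (hh.2.2 k j).symm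
  filter_upwards [h1 0, h1 1] with x h0 h1
  ext j
  fin_cases j
  · exact h0
  · exact h1

/-- Fourier multipliers commute, so the gradient may be taken before the semigroup acts; strong
continuity of the semigroup then yields the limit `τ → 0`. -/
lemma IsWeakGradient.gradHeat_eq {f : L2} {g : FieldL2} (hg : IsWeakGradient f g) {τ : ℝ}
    (hτ : 0 < τ) : gradHeat τ f = ∑ j, alongAxis j (semigroup τ (component 2 j g)) := by
  refine FieldL2_ext fun i => L2_ext fun k => ?_
  rw [fourierCoeff_component_gradHeat hτ]
  simp only [map_sum, component_alongAxis, Finset.sum_ite_eq, Finset.mem_univ, if_true]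
  rw [fourierCoeff_semigroup _ hτ.le, (isWeakGradient_iff f g).1 hg, heatDerivSymbol, mul_assoc]

/-- If `f` has a square integrable gradient, then `∇ e^{-τΔ²} f → ∇ f` as `τ → 0`. -/
lemma IsWeakGradient.tendsto_gradHeat {f : L2} {g : FieldL2} (hg : IsWeakGradient f g) :
    Tendsto (fun τ => gradHeat τ f) (𝓝[>] 0) (𝓝 g) := by
  have h : Tendsto (fun τ => ∑ j, alongAxis j (semigroup τ (component 2 j g))) (𝓝[>] 0)
      (𝓝 (∑ j, alongAxis j (component 2 j g))) := by
    refine tendsto_finsetSum _ fun j _ => ((alongAxis j).continuous.tendsto _).comp ?_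
    have := (continuousOn_semigroup (component 2 j g)) 0 self_mem_Ici
    rw [ContinuousWithinAt, semigroup_zero] at this
    exact this.mono_left (nhdsWithin_mono _ Ioi_subset_Ici_self)
  rw [sum_alongAxis_component] at h
  refine h.congr' ?_
  filter_upwards [self_mem_nhdsWithin] with τ hτ
  exact (hg.gradHeat_eq hτ).symm

lemma isWeakGradient_gradHeat (f : L2) {t : ℝ} (ht : 0 < t) :
    IsWeakGradient (semigroup t f) (gradHeat t f) := by
  rw [isWeakGradient_iff]
  intro k j
  rw [fourierCoeff_component_gradHeat ht, fourierCoeff_semigroup f ht.le, heatDerivSymbol]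
  ring

lemma isWeakGradient_gradDivHeat (H : FieldL1) {t : ℝ} (ht : 0 < t) :
    IsWeakGradient (divHeat t H) (gradDivHeat t H) := by
  rw [isWeakGradient_iff]
  exact fun k j => fourierCoeff_component_gradDivHeat ht H j k

lemma IsWeakGradient.sub {f f' : L2} {g g' : FieldL2} (h : IsWeakGradient f g)
    (h' : IsWeakGradient f' g') : IsWeakGradient (f - f' : L2) (g - g' : FieldL2) := by
  rw [isWeakGradient_iff] at h h' ⊢
  intro k j
  rw [map_sub, ← coeffCLM_apply, ← coeffCLM_apply, map_sub, map_sub, coeffCLM_apply, coeffCLM_apply,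
    coeffCLM_apply, coeffCLM_apply, h, h', mul_sub]

/-- In Fourier variables the relation is a family of continuous linear equations, and these pass
through Bochner integrals. -/
lemma isWeakGradient_intervalIntegral {f : ℝ → L2} {g : ℝ → FieldL2} {a b : ℝ} (hab : a ≤ b)
    (hf : IntervalIntegrable f volume a b) (hg : IntervalIntegrable g volume a b)
    (h : ∀ s ∈ Ioo a b, IsWeakGradient (f s) (g s)) :
    IsWeakGradient (∫ s in a..b, f s : L2) (∫ s in a..b, g s : FieldL2) := by
  rw [isWeakGradient_iff]
  intro k j
  rw [← ContinuousLinearMap.intervalIntegral_comp_comm _ hg, ← coeffCLM_apply, ← coeffCLM_apply,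
    ← ContinuousLinearMap.intervalIntegral_comp_comm _ hf,
    ← ContinuousLinearMap.intervalIntegral_comp_comm _
      ((intervalIntegrable_iff.2 ((component 2 j).integrable_comp (intervalIntegrable_iff.1 hg)))),
    ← intervalIntegral.integral_const_mul]
  rw [intervalIntegral.integral_of_le hab, intervalIntegral.integral_of_le hab,
    integral_Ioc_eq_integral_Ioo, integral_Ioc_eq_integral_Ioo]
  exact setIntegral_congr_fun measurableSet_Ioo fun s hs => (isWeakGradient_iff _ _).1 (h s hs) k j

/-! ### The flux as a map from `L²` to `L¹` -/

/-- Changing the direction costs `‖ξ‖^{p-2}‖ξ-η‖`. Changing the modulus costs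
`(‖ξ‖^{p-2}-‖η‖^{p-2})‖η‖`, which is at most `‖η‖^{p-2}(‖ξ‖-‖η‖)` because `r^{p-3}` decreases for `p
< 3`. -/
lemma norm_flux_sub_le_of_le {p : ℝ} (hp₂ : 2 < p) (hp₃ : p < 3) {ξ η : Plane} (h : ‖η‖ ≤ ‖ξ‖) :
    ‖flux p ξ - flux p η‖ ≤ (‖ξ‖ ^ (p - 2) + ‖η‖ ^ (p - 2)) * ‖ξ - η‖ := by
  have hsplit : flux p ξ - flux p η
      = ‖ξ‖ ^ (p - 2) • (ξ - η) + (‖ξ‖ ^ (p - 2) - ‖η‖ ^ (p - 2)) • η := by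
    rw [flux, flux, smul_sub, sub_smul]
    abel
  have hmono : ‖η‖ ^ (p - 2) ≤ ‖ξ‖ ^ (p - 2) :=
    Real.rpow_le_rpow (norm_nonneg _) h (by linarith)
  have hkey : (‖ξ‖ ^ (p - 2) - ‖η‖ ^ (p - 2)) * ‖η‖ ≤ ‖η‖ ^ (p - 2) * (‖ξ‖ - ‖η‖) := by
    rcases (norm_nonneg η).eq_or_lt' with h0 | h0
    · rw [h0, mul_zero, Real.zero_rpow (by linarith), zero_mul]
    · have hξ : 0 < ‖ξ‖ := h0.trans_le h
      have h1 : ‖ξ‖ ^ (p - 3) ≤ ‖η‖ ^ (p - 3) :=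
        Real.rpow_le_rpow_of_nonpos h0 h (by linarith)
      have h2 : ‖ξ‖ ^ (p - 2) = ‖ξ‖ ^ (p - 3) * ‖ξ‖ := by
        rw [← Real.rpow_add_one hξ.ne']; ring_nf
      have h3 : ‖η‖ ^ (p - 2) = ‖η‖ ^ (p - 3) * ‖η‖ := by
        rw [← Real.rpow_add_one h0.ne']; ring_nf
      rw [h2, h3]
      nlinarith [mul_le_mul_of_nonneg_right h1 (mul_nonneg hξ.le h0.le)]
  rw [hsplit]
  refine (norm_add_le _ _).trans ?_
  rw [norm_smul, norm_smul, Real.norm_of_nonneg (by positivity),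
    Real.norm_of_nonneg (sub_nonneg.2 hmono), add_mul]
  refine add_le_add le_rfl (hkey.trans ?_)
  exact mul_le_mul_of_nonneg_left (norm_sub_norm_le ξ η) (by positivity)

lemma norm_flux_sub_le {p : ℝ} (hp₂ : 2 < p) (hp₃ : p < 3) (ξ η : Plane) :
    ‖flux p ξ - flux p η‖ ≤ (‖ξ‖ ^ (p - 2) + ‖η‖ ^ (p - 2)) * ‖ξ - η‖ := by
  rcases le_total ‖η‖ ‖ξ‖ with h | h
  · exact norm_flux_sub_le_of_le hp₂ hp₃ h
  · rw [norm_sub_rev, norm_sub_rev ξ η, add_comm]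
    exact norm_flux_sub_le_of_le hp₂ hp₃ h

lemma flux_zero (p : ℝ) : flux p 0 = 0 := smul_zero _

lemma continuous_flux {p : ℝ} (hp₂ : 2 < p) : Continuous (flux p) :=
  (continuous_norm.rpow_const fun _ => Or.inr (by linarith)).smul continuous_id

/-- The `L²` norm of `|g|^q` is the `q`-th power of the `L^{2q}` norm of `g`; as `2q ≤ 2` and the
torus has mass one, the `L²` norm controls it. -/
lemma memLp_norm_rpow {q : ℝ} (hq₀ : 0 < q) (hq₁ : q ≤ 1) (g : FieldL2) :
    MemLp (fun x => ‖g x‖ ^ q) 2 dx ∧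
      (eLpNorm (fun x => ‖g x‖ ^ q) 2 dx).toReal ≤ ‖g‖ ^ q := by
  have hle : eLpNorm (fun x => ‖g x‖ ^ q) 2 dx ≤ eLpNorm g 2 dx ^ q := by
    rw [eLpNorm_norm_rpow _ hq₀]
    refine ENNReal.rpow_le_rpow ?_ hq₀.le
    refine eLpNorm_le_eLpNorm_of_exponent_le ?_ (Lp.memLp g).aestronglyMeasurable
    exact mul_le_of_le_one_right' (ENNReal.ofReal_le_one.2 hq₁)
  have hfin : eLpNorm g 2 dx ^ q ≠ ∞ :=
    ENNReal.rpow_ne_top_of_nonneg hq₀.le (Lp.memLp g).eLpNorm_ne_top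
  refine ⟨⟨?_, hle.trans_lt hfin.lt_top⟩, ?_⟩
  · exact ((continuous_norm.rpow_const fun _ => Or.inr hq₀.le).comp_aestronglyMeasurable
      (Lp.memLp g).aestronglyMeasurable)
  · rw [Lp.norm_def, ENNReal.toReal_rpow]
    exact ENNReal.toReal_mono hfin hle

lemma memLp_flux {p : ℝ} (hp₂ : 2 < p) (hp₃ : p < 3) (g : FieldL2) :
    MemLp (fun x => flux p (g x)) 1 dx := by
  rw [memLp_one_iff_integrable]
  have hint := (memLp_norm_rpow (q := p - 2) (by linarith) (by linarith) g).1.integrable_mul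
    (Lp.memLp g).norm
  refine hint.mono ((continuous_flux hp₂).comp_aestronglyMeasurable
    (Lp.memLp g).aestronglyMeasurable) (ae_of_all _ fun x => ?_)
  rw [flux, norm_smul, Pi.mul_apply, norm_mul, norm_norm]

open Classical in
/-- The flux `|g|^{p-2} g` of a square integrable vector field, as an element of `L¹`. -/
def fluxL1 (p : ℝ) (g : FieldL2) : FieldL1 :=
  if h : MemLp (fun x => flux p (g x)) 1 dx then h.toLp else 0

lemma fluxL1_ae {p : ℝ} (hp₂ : 2 < p) (hp₃ : p < 3) (g : FieldL2) :
    fluxL1 p g =ᵐ[dx] fun x => flux p (g x) := by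
  rw [fluxL1, dif_pos (memLp_flux hp₂ hp₃ g)]
  exact MemLp.coeFn_toLp _

lemma fluxL1_zero {p : ℝ} (hp₂ : 2 < p) (hp₃ : p < 3) : fluxL1 p 0 = 0 := by
  ext1
  filter_upwards [fluxL1_ae hp₂ hp₃ 0, Lp.coeFn_zero Plane 2 dx, Lp.coeFn_zero Plane 1 dx]
    with x h1 h2 h3
  rw [h1, h2, h3]
  exact flux_zero p

lemma norm_fluxL1_sub_le {p : ℝ} (hp₂ : 2 < p) (hp₃ : p < 3) (g h : FieldL2) :
    ‖fluxL1 p g - fluxL1 p h‖ ≤ (‖g‖ ^ (p - 2) + ‖h‖ ^ (p - 2)) * ‖g - h‖ := by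
  obtain ⟨hg, hg'⟩ := memLp_norm_rpow (q := p - 2) (by linarith) (by linarith) g
  obtain ⟨hh, hh'⟩ := memLp_norm_rpow (q := p - 2) (by linarith) (by linarith) h
  have hd := (Lp.memLp (g - h)).norm
  have hA : ‖hg.toLp‖ ≤ ‖g‖ ^ (p - 2) := by rw [Lp.norm_toLp]; exact hg'
  have hB : ‖hh.toLp‖ ≤ ‖h‖ ^ (p - 2) := by rw [Lp.norm_toLp]; exact hh'
  have hN : ‖hd.toLp‖ = ‖g - h‖ := by
    rw [Lp.norm_toLp, eLpNorm_norm, Lp.norm_def]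
  -- The pointwise Lipschitz bound is integrated into an `L²` inner product, ready for
  -- Cauchy–Schwarz.
  have hinner : ∫ x, ‖(fluxL1 p g - fluxL1 p h) x‖ ∂dx
      ≤ inner ℝ (hg.toLp + hh.toLp) hd.toLp := by
    rw [L2.inner_def]
    refine integral_mono_ae (L1.integrable_coeFn _).norm
      (L2.integrable_inner _ _) ?_
    filter_upwards [Lp.coeFn_sub (fluxL1 p g) (fluxL1 p h), fluxL1_ae hp₂ hp₃ g,
      fluxL1_ae hp₂ hp₃ h, Lp.coeFn_add hg.toLp hh.toLp, hg.coeFn_toLp, hh.coeFn_toLp,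
      hd.coeFn_toLp, Lp.coeFn_sub g h] with x h1 h2 h3 h4 h5 h6 h7 h8
    rw [h1, h4, h7, h8, Pi.sub_apply, Pi.add_apply, Pi.sub_apply, h2, h3, h5, h6]
    simp only [RCLike.inner_apply, conj_trivial]
    rw [mul_comm]
    exact norm_flux_sub_le hp₂ hp₃ _ _
  rw [L1.norm_eq_integral_norm]
  refine hinner.trans ((real_inner_le_norm _ _).trans ?_)
  rw [hN]
  refine mul_le_mul_of_nonneg_right ?_ (norm_nonneg _)
  exact (norm_add_le _ _).trans (add_le_add hA hB)

lemma norm_fluxL1_le {p : ℝ} (hp₂ : 2 < p) (hp₃ : p < 3) (g : FieldL2) :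
    ‖fluxL1 p g‖ ≤ ‖g‖ ^ (p - 2) * ‖g‖ := by
  have := norm_fluxL1_sub_le hp₂ hp₃ g 0
  rwa [fluxL1_zero hp₂ hp₃, sub_zero, sub_zero, norm_zero, Real.zero_rpow (by linarith),
    add_zero] at this

lemma continuous_fluxL1 {p : ℝ} (hp₂ : 2 < p) (hp₃ : p < 3) : Continuous (fluxL1 p) := by
  refine continuous_iff_continuousAt.2 fun g => ?_
  rw [ContinuousAt, tendsto_iff_norm_sub_tendsto_zero]
  have hlim : Tendsto (fun h : FieldL2 => (‖h‖ ^ (p - 2) + ‖g‖ ^ (p - 2)) * ‖h - g‖) (𝓝 g)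
      (𝓝 ((‖g‖ ^ (p - 2) + ‖g‖ ^ (p - 2)) * ‖g - g‖)) := by
    refine Continuous.tendsto ?_ g
    exact ((continuous_norm.rpow_const fun _ => Or.inr (by linarith)).add continuous_const).mul
      (continuous_id.sub continuous_const).norm
  rw [sub_self, norm_zero, mul_zero] at hlim
  exact squeeze_zero (fun _ => norm_nonneg _) (fun h => norm_fluxL1_sub_le hp₂ hp₃ h g) hlim

/-! ### Singular convolutions -/

/-- The integrand is the real part of that of Euler's Beta integral at `(1-b, 1-a)`. -/
lemma intervalIntegrable_beta_kernel {a b : ℝ} (ha : a < 1) (hb : b < 1) :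
    IntervalIntegrable (fun r : ℝ => (1 - r) ^ (-a) * r ^ (-b)) volume 0 1 := by
  have h := Complex.betaIntegral_convergent (u := ((1 - b : ℝ) : ℂ)) (v := ((1 - a : ℝ) : ℂ))
    (by simpa using hb) (by simpa using ha)
  rw [intervalIntegrable_iff_integrableOn_Ioc_of_le zero_le_one] at h ⊢
  refine (IntegrableOn.congr_fun h.re ?_ measurableSet_Ioc)
  intro r hr
  have h1 : ((1 - b : ℝ) : ℂ) - 1 = ((-b : ℝ) : ℂ) := by push_cast; ring
  have h2 : ((1 - a : ℝ) : ℂ) - 1 = ((-a : ℝ) : ℂ) := by push_cast; ring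
  have h3 : (1 : ℂ) - (r : ℂ) = ((1 - r : ℝ) : ℂ) := by push_cast; ring
  simp only [h1, h2, h3]
  rw [← Complex.ofReal_cpow hr.1.le, ← Complex.ofReal_cpow (by linarith [hr.2]),
    ← Complex.ofReal_mul]
  simp [mul_comm]

/-- The constant `∫₀¹ (1-r)^{-a} r^{-b} dr`. -/
def betaConst (a b : ℝ) : ℝ := ∫ r in (0 : ℝ)..1, (1 - r) ^ (-a) * r ^ (-b)

lemma betaConst_nonneg (a b : ℝ) : 0 ≤ betaConst a b :=
  intervalIntegral.integral_nonneg zero_le_one fun r hr =>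
    mul_nonneg (Real.rpow_nonneg (by linarith [hr.2]) _) (Real.rpow_nonneg hr.1 _)

lemma beta_kernel_rescale {a b t r : ℝ} (ht : 0 < t) (hr₀ : 0 ≤ r) (hr₁ : r ≤ 1) :
    (t - t * r) ^ (-a) * (t * r) ^ (-b) = t ^ (-a - b) * ((1 - r) ^ (-a) * r ^ (-b)) := by
  rw [show t - t * r = t * (1 - r) by ring, Real.mul_rpow ht.le (by linarith),
    Real.mul_rpow ht.le hr₀, show -a - b = -a + -b by ring, Real.rpow_add ht]
  ring

lemma intervalIntegrable_singular_kernel {a b t : ℝ} (ha : a < 1) (hb : b < 1) (ht : 0 < t) :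
    IntervalIntegrable (fun s : ℝ => (t - s) ^ (-a) * s ^ (-b)) volume 0 t := by
  have h : IntervalIntegrable (fun r : ℝ => (t - t * r) ^ (-a) * (t * r) ^ (-b)) volume 0 1 := by
    refine ((intervalIntegrable_beta_kernel ha hb).const_mul (t ^ (-a - b))).congr ?_
    rw [uIoc_of_le zero_le_one]
    intro r hr
    exact (beta_kernel_rescale ht hr.1.le hr.2).symm
  have h2 := (IntervalIntegrable.comp_mul_left_iff (f := fun s : ℝ => (t - s) ^ (-a) * s ^ (-b))
    (a := 0) (b := t) ht.ne' enorm_ne_top enorm_ne_top).1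
  rw [zero_div, div_self ht.ne'] at h2
  exact h2 h

lemma integral_singular_kernel {a b t : ℝ} (ht : 0 < t) :
    ∫ s in (0 : ℝ)..t, (t - s) ^ (-a) * s ^ (-b) = betaConst a b * t ^ (1 - a - b) := by
  have h := intervalIntegral.integral_comp_mul_left (a := 0) (b := 1)
    (fun s : ℝ => (t - s) ^ (-a) * s ^ (-b)) ht.ne'
  rw [mul_zero, mul_one, smul_eq_mul, eq_inv_mul_iff_mul_eq₀ ht.ne'] at h
  rw [← h, show (1 : ℝ) - a - b = 1 + (-a - b) by ring, Real.rpow_add ht, Real.rpow_one, betaConst]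
  have hcongr : ∫ r in (0 : ℝ)..1, (t - t * r) ^ (-a) * (t * r) ^ (-b)
      = ∫ r in (0 : ℝ)..1, t ^ (-a - b) * ((1 - r) ^ (-a) * r ^ (-b)) := by
    refine intervalIntegral.integral_congr fun r hr => ?_
    rw [uIcc_of_le zero_le_one] at hr
    exact beta_kernel_rescale ht hr.1 hr.2
  rw [hcongr, intervalIntegral.integral_const_mul]
  ring

section Convolution

variable {X Z : Type*} [NormedAddCommGroup X] [NormedSpace ℝ X] [NormedAddCommGroup Z]
  [NormedSpace ℝ Z] {K : ℝ → X →L[ℝ] Z} {H : ℝ → X} {a b C M : ℝ}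

lemma norm_kernel_apply_le (hK : ∀ τ, 0 < τ → ‖K τ‖ ≤ C * τ ^ (-a))
    (hH : ∀ s, 0 < s → ‖H s‖ ≤ M * s ^ (-b)) {t s : ℝ} (hs : s ∈ Ioo 0 t) :
    ‖K (t - s) (H s)‖ ≤ C * M * ((t - s) ^ (-a) * s ^ (-b)) := by
  have h1 : 0 < t - s := sub_pos.2 hs.2
  refine ((K (t - s)).le_opNorm _).trans ?_
  calc ‖K (t - s)‖ * ‖H s‖ ≤ (C * (t - s) ^ (-a)) * (M * s ^ (-b)) :=
        mul_le_mul (hK _ h1) (hH s hs.1) (norm_nonneg _) ((norm_nonneg _).trans (hK _ h1))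
    _ = C * M * ((t - s) ^ (-a) * s ^ (-b)) := by ring

lemma continuousOn_kernel_apply (hKc : ContinuousOn K (Ioi 0)) (hHc : ContinuousOn H (Ioi 0))
    (t : ℝ) : ContinuousOn (fun s => K (t - s) (H s)) (Ioo 0 t) := by
  refine ContinuousOn.clm_apply (hKc.comp (by fun_prop) fun s hs => ?_)
    (hHc.mono Ioo_subset_Ioi_self)
  exact mem_Ioi.2 (sub_pos.2 hs.2)

lemma intervalIntegrable_convolution (ha : a < 1) (hb : b < 1) (hKc : ContinuousOn K (Ioi 0))
    (hK : ∀ τ, 0 < τ → ‖K τ‖ ≤ C * τ ^ (-a)) (hHc : ContinuousOn H (Ioi 0))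
    (hH : ∀ s, 0 < s → ‖H s‖ ≤ M * s ^ (-b)) {t : ℝ} (ht : 0 < t) :
    IntervalIntegrable (fun s => K (t - s) (H s)) volume 0 t := by
  have hker := (intervalIntegrable_singular_kernel ha hb ht).const_mul (C * M)
  rw [intervalIntegrable_iff_integrableOn_Ioo_of_le ht.le] at hker ⊢
  refine Integrable.mono' hker
    ((continuousOn_kernel_apply hKc hHc t).aestronglyMeasurable measurableSet_Ioo) ?_
  exact (ae_restrict_iff' measurableSet_Ioo).2 (ae_of_all _ fun s hs =>
    norm_kernel_apply_le hK hH hs)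

lemma norm_convolution_le (ha : a < 1) (hb : b < 1) (hK : ∀ τ, 0 < τ → ‖K τ‖ ≤ C * τ ^ (-a))
    (hH : ∀ s, 0 < s → ‖H s‖ ≤ M * s ^ (-b)) {t : ℝ} (ht : 0 < t) :
    ‖∫ s in (0 : ℝ)..t, K (t - s) (H s)‖ ≤ C * M * betaConst a b * t ^ (1 - a - b) := by
  have hker := (intervalIntegrable_singular_kernel ha hb ht).const_mul (C * M)
  rw [mul_assoc _ (betaConst a b), ← integral_singular_kernel ht,
    ← intervalIntegral.integral_const_mul, intervalIntegral.integral_of_le ht.le,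
    intervalIntegral.integral_of_le ht.le, integral_Ioc_eq_integral_Ioo,
    integral_Ioc_eq_integral_Ioo]
  rw [intervalIntegrable_iff_integrableOn_Ioo_of_le ht.le] at hker
  exact norm_integral_le_of_norm_le hker ((ae_restrict_iff' measurableSet_Ioo).2
    (ae_of_all _ fun s hs => norm_kernel_apply_le hK hH hs))

lemma convolution_eq_smul_integral {t : ℝ} (ht : 0 < t) :
    ∫ s in (0 : ℝ)..t, K (t - s) (H s)
      = t • ∫ r in (0 : ℝ)..1, K (t - t * r) (H (t * r)) := by
  rw [intervalIntegral.integral_comp_mul_left (fun s => K (t - s) (H s)) ht.ne', smul_smul,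
    mul_inv_cancel₀ ht.ne', one_smul, mul_zero, mul_one]

/-- The substitution `s = tr` fixes the interval of integration. The integrand is then continuous in
`t` for each `0 < r < 1`, and a Beta kernel dominates it locally uniformly in `t`. -/
lemma continuousOn_convolution (ha : a < 1) (hb : b < 1) (hKc : ContinuousOn K (Ioi 0))
    (hK : ∀ τ, 0 < τ → ‖K τ‖ ≤ C * τ ^ (-a)) (hHc : ContinuousOn H (Ioi 0))
    (hH : ∀ s, 0 < s → ‖H s‖ ≤ M * s ^ (-b)) :
    ContinuousOn (fun t => ∫ s in (0 : ℝ)..t, K (t - s) (H s)) (Ioi 0) := by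
  intro t₀ ht₀
  have ht₀' : 0 < t₀ := ht₀
  have hmem : ∀ t r : ℝ, 0 < t → r ∈ Ioo (0 : ℝ) 1 → t * r ∈ Ioo 0 t := fun t r ht hr =>
    ⟨mul_pos ht hr.1, by nlinarith [hr.2]⟩
  have hpow : ∀ᶠ t : ℝ in 𝓝 t₀, t ^ (-a - b) < t₀ ^ (-a - b) + 1 :=
    (Real.continuousAt_rpow_const t₀ _ (Or.inl ht₀'.ne')).eventually_lt_const (lt_add_one _)
  have hev : ∀ᶠ t : ℝ in 𝓝 t₀, 0 < t ∧ t ^ (-a - b) < t₀ ^ (-a - b) + 1 :=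
    (lt_mem_nhds ht₀').and hpow
  have hCM : 0 ≤ C * M := by
    have h1 := (norm_nonneg _).trans (hK 1 one_pos)
    have h2 := (norm_nonneg _).trans (hH 1 one_pos)
    rw [Real.one_rpow, mul_one] at h1 h2
    exact mul_nonneg h1 h2
  have hint : ContinuousAt (fun t => ∫ r in (0 : ℝ)..1, K (t - t * r) (H (t * r))) t₀ := by
    refine intervalIntegral.continuousAt_of_dominated_interval
      (bound := fun r => C * M * ((t₀ ^ (-a - b) + 1) * ((1 - r) ^ (-a) * r ^ (-b)))) ?_ ?_ ?_ ?_
    · refine hev.mono fun t ht => ?_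
      rw [uIoc_of_le zero_le_one, ← Measure.restrict_congr_set Ioo_ae_eq_Ioc]
      refine ContinuousOn.aestronglyMeasurable ?_ measurableSet_Ioo
      exact (continuousOn_kernel_apply hKc hHc t).comp (by fun_prop) fun r hr => hmem t r ht.1 hr
    · refine hev.mono fun t ht => ?_
      rw [uIoc_of_le zero_le_one]
      have hne : ∀ᵐ r : ℝ, r ≠ 1 := by simp [ae_iff]
      filter_upwards [hne] with r hr1 hr
      have hr' : r ∈ Ioo (0 : ℝ) 1 := ⟨hr.1, lt_of_le_of_ne hr.2 hr1⟩
      refine (norm_kernel_apply_le hK hH (hmem t r ht.1 hr')).trans ?_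
      rw [beta_kernel_rescale ht.1 hr.1.le hr.2]
      have h0 : 0 ≤ (1 - r) ^ (-a) * r ^ (-b) :=
        mul_nonneg (Real.rpow_nonneg (by linarith [hr.2]) _) (Real.rpow_nonneg hr.1.le _)
      exact mul_le_mul_of_nonneg_left (mul_le_mul_of_nonneg_right ht.2.le h0) hCM
    · exact ((intervalIntegrable_beta_kernel ha hb).const_mul _).const_mul _
    · have hne : ∀ᵐ r : ℝ, r ≠ 1 := by simp [ae_iff]
      rw [uIoc_of_le zero_le_one]
      filter_upwards [hne] with r hr1 hr
      have hr' : r ∈ Ioo (0 : ℝ) 1 := ⟨hr.1, lt_of_le_of_ne hr.2 hr1⟩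
      have hm := hmem t₀ r ht₀' hr'
      have hK' : ContinuousAt K (t₀ - t₀ * r) := hKc.continuousAt (Ioi_mem_nhds (sub_pos.2 hm.2))
      have hH' : ContinuousAt H (t₀ * r) := hHc.continuousAt (Ioi_mem_nhds hm.1)
      have h1 : ContinuousAt (fun t => K (t - t * r)) t₀ :=
        ContinuousAt.comp (f := fun t : ℝ => t - t * r) hK' (by fun_prop)
      have h2 : ContinuousAt (fun t => H (t * r)) t₀ :=
        ContinuousAt.comp (f := fun t : ℝ => t * r) hH' (by fun_prop)
      exact h1.clm_apply h2
  have hsm : ContinuousAt (fun t : ℝ => t • ∫ r in (0 : ℝ)..1, K (t - t * r) (H (t * r))) t₀ :=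
    continuousAt_id.smul hint
  exact hsm.continuousWithinAt.congr (fun t ht => convolution_eq_smul_integral ht)
    (convolution_eq_smul_integral ht₀')

/-- The new point is `t = 0`, where `a + b < 1` makes the bound `t^{1-a-b}` tend to zero. -/
lemma continuousOn_convolution_Ici (ha : a < 1) (hb : b < 1) (hab : a + b < 1)
    (hKc : ContinuousOn K (Ioi 0)) (hK : ∀ τ, 0 < τ → ‖K τ‖ ≤ C * τ ^ (-a))
    (hHc : ContinuousOn H (Ioi 0)) (hH : ∀ s, 0 < s → ‖H s‖ ≤ M * s ^ (-b)) :
    ContinuousOn (fun t => ∫ s in (0 : ℝ)..t, K (t - s) (H s)) (Ici 0) := by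
  intro t₀ ht₀
  rcases eq_or_lt_of_le (mem_Ici.1 ht₀) with rfl | h
  · rw [ContinuousWithinAt, intervalIntegral.integral_same]
    have hlim : Tendsto (fun t : ℝ => C * M * betaConst a b * t ^ (1 - a - b)) (𝓝[≥] 0) (𝓝 0) := by
      have h1 : ContinuousAt (fun t : ℝ => t ^ (1 - a - b)) 0 :=
        Real.continuousAt_rpow_const 0 _ (Or.inr (by linarith))
      have h2 := (h1.tendsto.mono_left (nhdsWithin_le_nhds (s := Ici 0))).const_mul
        (C * M * betaConst a b)
      rwa [Real.zero_rpow (by linarith), mul_zero] at h2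
    refine squeeze_zero_norm' ?_ hlim
    filter_upwards [self_mem_nhdsWithin] with t ht
    rcases eq_or_lt_of_le (mem_Ici.1 ht) with rfl | h
    · simp [Real.zero_rpow (by linarith : 1 - a - b ≠ 0)]
    · exact norm_convolution_le ha hb hK hH h
  · exact ((continuousOn_convolution ha hb hKc hK hHc hH).continuousAt
      (Ioi_mem_nhds h)).continuousWithinAt

end Convolution

/-! ### Exponents and constants -/

/-- The small loss `ε = (3-p)/8` in the smoothing estimates. -/
def slack (p : ℝ) : ℝ := (3 - p) / 8

lemma slack_pos {p : ℝ} (hp₃ : p < 3) : 0 < slack p := by unfold slack; linarith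

lemma half_lt_half_add_slack {p : ℝ} (hp₃ : p < 3) : 1 / 2 < 1 / 2 + slack p := by
  linarith [slack_pos hp₃]

lemma half_add_slack_le {p : ℝ} (hp₂ : 2 < p) : 1 / 2 + slack p ≤ 1 := by unfold slack; linarith

/-- The decay exponent of `∇ ∇ · e^{-τΔ²}` from `L¹` to `L²`. -/
def kernelExp (p : ℝ) : ℝ := 1 / 2 + slack p + 1 / 4

/-- The decay exponent of the flux in `L¹`. -/
def fluxExp (p : ℝ) : ℝ := (p - 1) / 4

lemma kernelExp_lt_one {p : ℝ} (hp₂ : 2 < p) : kernelExp p < 1 := by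
  unfold kernelExp slack; linarith

lemma fluxExp_lt_one {p : ℝ} (hp₃ : p < 3) : fluxExp p < 1 := by unfold fluxExp; linarith

lemma exists_gradDivHeat_bound {p : ℝ} (hp₂ : 2 < p) (hp₃ : p < 3) :
    ∃ C, 0 ≤ C ∧ ∀ τ, 0 < τ → ‖gradDivHeat τ‖ ≤ C * τ ^ (-kernelExp p) :=
  ⟨16 * ‖normWeight (half_lt_half_add_slack hp₃)‖, by positivity, fun _ hτ =>
    norm_gradDivHeat_le hτ (half_lt_half_add_slack hp₃) (half_add_slack_le hp₂)⟩

lemma exists_divHeat_bound {p : ℝ} (hp₂ : 2 < p) (hp₃ : p < 3) :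
    ∃ C, ∀ τ, 0 < τ → ‖divHeat τ‖ ≤ C * τ ^ (-(1 / 2 + slack p)) :=
  ⟨_, fun _ hτ => norm_divHeat_le hτ (half_lt_half_add_slack hp₃) (half_add_slack_le hp₂)⟩

/-! ### The flux along curves with a singularity at time zero -/

lemma rpow_mul_singular {p R s : ℝ} (hR : 0 ≤ R) (hs : 0 < s) (N : ℝ) :
    (R * s ^ (-(1 / 4) : ℝ)) ^ (p - 2) * (N * s ^ (-(1 / 4) : ℝ))
      = R ^ (p - 2) * N * s ^ (-fluxExp p) := by
  rw [Real.mul_rpow hR (by positivity), ← Real.rpow_mul hs.le,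
    show -fluxExp p = -(1 / 4) * (p - 2) + -(1 / 4) by unfold fluxExp; ring, Real.rpow_add hs]
  ring

lemma norm_fluxL1_le_singular {p : ℝ} (hp₂ : 2 < p) (hp₃ : p < 3) {G : FieldL2} {R s : ℝ}
    (hR : 0 ≤ R) (hs : 0 < s) (hG : ‖G‖ ≤ R * s ^ (-(1 / 4) : ℝ)) :
    ‖fluxL1 p G‖ ≤ R ^ (p - 2) * R * s ^ (-fluxExp p) := by
  rw [← rpow_mul_singular hR hs]
  refine (norm_fluxL1_le hp₂ hp₃ G).trans ?_
  exact mul_le_mul (Real.rpow_le_rpow (norm_nonneg _) hG (by linarith)) hG (norm_nonneg _)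
    (by positivity)

lemma norm_fluxL1_sub_le_singular {p : ℝ} (hp₂ : 2 < p) (hp₃ : p < 3) {G G' : FieldL2}
    {R N s : ℝ} (hR : 0 ≤ R) (hs : 0 < s) (hG : ‖G‖ ≤ R * s ^ (-(1 / 4) : ℝ))
    (hG' : ‖G'‖ ≤ R * s ^ (-(1 / 4) : ℝ)) (hN : ‖G - G'‖ ≤ N * s ^ (-(1 / 4) : ℝ)) :
    ‖fluxL1 p G - fluxL1 p G'‖ ≤ 2 * R ^ (p - 2) * N * s ^ (-fluxExp p) := by
  rw [mul_assoc 2, mul_assoc 2, ← rpow_mul_singular hR hs, ← mul_assoc, two_mul]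
  refine (norm_fluxL1_sub_le hp₂ hp₃ G G').trans ?_
  refine mul_le_mul (add_le_add ?_ ?_) hN (norm_nonneg _) (by positivity)
  · exact Real.rpow_le_rpow (norm_nonneg _) hG (by linarith)
  · exact Real.rpow_le_rpow (norm_nonneg _) hG' (by linarith)

/-! ### The fixed point argument for the gradient -/

/-- The Duhamel map for the gradient. -/
def gradDuhamel (p : ℝ) (u₀ : L2) (G : ℝ → FieldL2) (t : ℝ) : FieldL2 :=
  gradHeat t u₀ - ∫ s in (0 : ℝ)..t, gradDivHeat (t - s) (fluxL1 p (G s))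

/-- The curve `s^{-1/4} W(log s)`. -/
def ofLogTime (W : ℝ →ᵇ FieldL2) (s : ℝ) : FieldL2 := s ^ (-(1 / 4) : ℝ) • W (Real.log s)

lemma continuousOn_ofLogTime (W : ℝ →ᵇ FieldL2) : ContinuousOn (ofLogTime W) (Ioi 0) := by
  have h : ContinuousOn (fun s : ℝ => s ^ (-(1 / 4) : ℝ)) (Ioi 0) := fun s hs =>
    (Real.continuousAt_rpow_const s _ (Or.inl (ne_of_gt hs))).continuousWithinAt
  exact h.smul (W.continuous.comp_continuousOn
    (Real.continuousOn_log.mono fun s hs => ne_of_gt hs))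

lemma norm_ofLogTime_le (W : ℝ →ᵇ FieldL2) {s : ℝ} (hs : 0 < s) :
    ‖ofLogTime W s‖ ≤ ‖W‖ * s ^ (-(1 / 4) : ℝ) := by
  rw [ofLogTime, norm_smul, Real.norm_of_nonneg (by positivity), mul_comm]
  exact mul_le_mul_of_nonneg_right (W.norm_coe_le_norm _) (by positivity)

lemma norm_ofLogTime_sub_le (W W' : ℝ →ᵇ FieldL2) {s : ℝ} (hs : 0 < s) :
    ‖ofLogTime W s - ofLogTime W' s‖ ≤ ‖W - W'‖ * s ^ (-(1 / 4) : ℝ) := by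
  have : ofLogTime W s - ofLogTime W' s = ofLogTime (W - W') s := by
    simp [ofLogTime, smul_sub]
  rw [this]
  exact norm_ofLogTime_le _ hs

lemma continuousOn_gradDuhamel {p : ℝ} (hp₂ : 2 < p) (hp₃ : p < 3) (u₀ : L2) {G : ℝ → FieldL2}
    {R : ℝ} (hR : 0 ≤ R) (hGc : ContinuousOn G (Ioi 0))
    (hG : ∀ s, 0 < s → ‖G s‖ ≤ R * s ^ (-(1 / 4) : ℝ)) :
    ContinuousOn (gradDuhamel p u₀ G) (Ioi 0) := by
  obtain ⟨C, -, hC⟩ := exists_gradDivHeat_bound hp₂ hp₃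
  refine (continuousOn_gradHeat.clm_apply continuousOn_const).sub ?_
  exact continuousOn_convolution (kernelExp_lt_one hp₂) (fluxExp_lt_one hp₃)
    continuousOn_gradDivHeat hC ((continuous_fluxL1 hp₂ hp₃).comp_continuousOn hGc)
    fun s hs => norm_fluxL1_le_singular hp₂ hp₃ hR hs (hG s hs)

/-- The scaling count of the fixed point argument: the net power of time is `slack p`, positive
exactly when `p < 3`. -/
lemma quarter_add_exponent (p : ℝ) : 1 / 4 + (1 - kernelExp p - fluxExp p) = slack p := by
  unfold kernelExp fluxExp slack; ring

/-- The weighted gradient Duhamel map is bounded and Lipschitz in the weighted norm. -/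
lemma exists_gradDuhamel_bounds {p : ℝ} (hp₂ : 2 < p) (hp₃ : p < 3) :
    ∃ A, 0 ≤ A ∧ ∀ (u₀ : L2) (W W' : ℝ →ᵇ FieldL2) (R T t : ℝ), ‖W‖ ≤ R → ‖W'‖ ≤ R → 0 < t →
      t ≤ T →
      ‖t ^ (1 / 4 : ℝ) • gradDuhamel p u₀ (ofLogTime W) t‖
        ≤ 2 * ‖u₀‖ + A * (R ^ (p - 2) * R) * T ^ slack p ∧
      ‖t ^ (1 / 4 : ℝ) • gradDuhamel p u₀ (ofLogTime W) t
          - t ^ (1 / 4 : ℝ) • gradDuhamel p u₀ (ofLogTime W') t‖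
        ≤ A * (2 * R ^ (p - 2)) * T ^ slack p * ‖W - W'‖ := by
  obtain ⟨C, hC0, hC⟩ := exists_gradDivHeat_bound hp₂ hp₃
  refine ⟨C * betaConst (kernelExp p) (fluxExp p), mul_nonneg hC0 (betaConst_nonneg _ _), ?_⟩
  intro u₀ W W' R T t hW hW' ht htT
  have hR : 0 ≤ R := (norm_nonneg _).trans hW
  have ha := kernelExp_lt_one hp₂
  have hb := fluxExp_lt_one hp₃
  have hbd : ∀ V : ℝ →ᵇ FieldL2, ‖V‖ ≤ R → ∀ s, 0 < s →
      ‖ofLogTime V s‖ ≤ R * s ^ (-(1 / 4) : ℝ) := fun V hV s hs =>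
    (norm_ofLogTime_le V hs).trans (mul_le_mul_of_nonneg_right hV (by positivity))
  have hfl : ∀ V : ℝ →ᵇ FieldL2, ‖V‖ ≤ R → ∀ s, 0 < s →
      ‖fluxL1 p (ofLogTime V s)‖ ≤ R ^ (p - 2) * R * s ^ (-fluxExp p) := fun V hV s hs =>
    norm_fluxL1_le_singular hp₂ hp₃ hR hs (hbd V hV s hs)
  have hcont : ∀ V : ℝ →ᵇ FieldL2, ContinuousOn (fun s => fluxL1 p (ofLogTime V s)) (Ioi 0) :=
    fun V => (continuous_fluxL1 hp₂ hp₃).comp_continuousOn (continuousOn_ofLogTime V)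
  have hint : ∀ V : ℝ →ᵇ FieldL2, ‖V‖ ≤ R → IntervalIntegrable
      (fun s => gradDivHeat (t - s) (fluxL1 p (ofLogTime V s))) volume 0 t := fun V hV =>
    intervalIntegrable_convolution ha hb continuousOn_gradDivHeat hC (hcont V) (hfl V hV) ht
  have hpow : t ^ (1 / 4 : ℝ) * t ^ (1 - kernelExp p - fluxExp p) ≤ T ^ slack p := by
    rw [← Real.rpow_add ht, quarter_add_exponent]
    exact Real.rpow_le_rpow ht.le htT (slack_pos hp₃).le
  have hB := betaConst_nonneg (kernelExp p) (fluxExp p)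
  constructor
  · have h1 := norm_convolution_le ha hb hC (hfl W hW) ht
    have h2 : ‖gradHeat t u₀‖ ≤ 2 * t ^ (-(1 / 4) : ℝ) * ‖u₀‖ :=
      (gradHeat t).le_of_opNorm_le (norm_gradHeat_le ht) u₀
    rw [norm_smul, Real.norm_of_nonneg (by positivity)]
    have hcancel : t ^ (1 / 4 : ℝ) * t ^ (-(1 / 4) : ℝ) = 1 := by
      rw [← Real.rpow_add ht]; norm_num
    calc t ^ (1 / 4 : ℝ) * ‖gradDuhamel p u₀ (ofLogTime W) t‖
        ≤ t ^ (1 / 4 : ℝ) * (2 * t ^ (-(1 / 4) : ℝ) * ‖u₀‖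
          + C * (R ^ (p - 2) * R) * betaConst (kernelExp p) (fluxExp p)
            * t ^ (1 - kernelExp p - fluxExp p)) := by
          gcongr
          exact (norm_sub_le _ _).trans (add_le_add h2 h1)
      _ = 2 * ‖u₀‖ * (t ^ (1 / 4 : ℝ) * t ^ (-(1 / 4) : ℝ))
          + C * betaConst (kernelExp p) (fluxExp p) * (R ^ (p - 2) * R)
            * (t ^ (1 / 4 : ℝ) * t ^ (1 - kernelExp p - fluxExp p)) := by ring
      _ ≤ 2 * ‖u₀‖ + C * betaConst (kernelExp p) (fluxExp p) * (R ^ (p - 2) * R)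
          * T ^ slack p := by
          rw [hcancel, mul_one]
          gcongr
  · have hsub : gradDuhamel p u₀ (ofLogTime W) t - gradDuhamel p u₀ (ofLogTime W') t
        = -∫ s in (0 : ℝ)..t, gradDivHeat (t - s)
            (fluxL1 p (ofLogTime W s) - fluxL1 p (ofLogTime W' s)) := by
      simp only [map_sub]
      rw [intervalIntegral.integral_sub (hint W hW) (hint W' hW'), gradDuhamel, gradDuhamel]
      abel
    have h1 := norm_convolution_le ha hb hC (t := t)
      (fun s hs => norm_fluxL1_sub_le_singular hp₂ hp₃ hR hs (hbd W hW s hs) (hbd W' hW' s hs)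
        (norm_ofLogTime_sub_le W W' hs)) ht
    rw [← smul_sub, hsub, norm_smul, norm_neg, Real.norm_of_nonneg (by positivity)]
    calc t ^ (1 / 4 : ℝ) * ‖∫ s in (0 : ℝ)..t, gradDivHeat (t - s)
            (fluxL1 p (ofLogTime W s) - fluxL1 p (ofLogTime W' s))‖
        ≤ t ^ (1 / 4 : ℝ) * (C * (2 * R ^ (p - 2) * ‖W - W'‖)
            * betaConst (kernelExp p) (fluxExp p) * t ^ (1 - kernelExp p - fluxExp p)) := by
          gcongr
      _ = C * betaConst (kernelExp p) (fluxExp p) * (2 * R ^ (p - 2)) * ‖W - W'‖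
            * (t ^ (1 / 4 : ℝ) * t ^ (1 - kernelExp p - fluxExp p)) := by ring
      _ ≤ C * betaConst (kernelExp p) (fluxExp p) * (2 * R ^ (p - 2)) * ‖W - W'‖
            * T ^ slack p := by gcongr
      _ = _ := by ring

/-- The radius of the ball in which the fixed point is found. -/
def ballRadius (r : ℝ) : ℝ := 4 * |r| + 1

lemma ballRadius_pos (r : ℝ) : 0 < ballRadius r := by unfold ballRadius; positivity

/-- Existence of a fixed point of the gradient Duhamel map on a time interval that depends only on
`p` and on the norm of the initial datum. -/
lemma exists_gradDuhamel_fixedPoint {p : ℝ} (hp₂ : 2 < p) (hp₃ : p < 3) :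
    ∃ T : ℝ → ℝ, (∀ r, 0 < T r ∧ T r ≤ 1) ∧ ∀ u₀ : L2, ∃ (G : ℝ → FieldL2) (R : ℝ), 0 ≤ R ∧
      ContinuousOn G (Ioi 0) ∧ (∀ s, 0 < s → ‖G s‖ ≤ R * s ^ (-(1 / 4) : ℝ)) ∧
      ∀ t ∈ Ioc 0 (T ‖u₀‖), G t = gradDuhamel p u₀ G t := by
  obtain ⟨A, hA0, hA⟩ := exists_gradDuhamel_bounds hp₂ hp₃
  have hε := slack_pos hp₃
  have hD : ∀ r, 1 ≤ 4 * A * ballRadius r ^ (p - 2) + 1 := fun r => by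
    have := ballRadius_pos r
    have : 0 ≤ 4 * A * ballRadius r ^ (p - 2) := by positivity
    linarith
  -- Chosen so that, with `x = A R^{p-2}`, the quantity `x T^ε` equals `x / (4x + 1) ≤ 1/4`.
  refine ⟨fun r => (4 * A * ballRadius r ^ (p - 2) + 1) ^ (-(slack p)⁻¹), fun r => ⟨?_, ?_⟩, ?_⟩
  · exact Real.rpow_pos_of_pos (by linarith [hD r]) _
  · exact Real.rpow_le_one_of_one_le_of_nonpos (hD r) (by simpa using hε.le)
  intro u₀
  set R := ballRadius ‖u₀‖ with hRdef
  have hR : 0 < R := ballRadius_pos _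
  set T := (4 * A * R ^ (p - 2) + 1) ^ (-(slack p)⁻¹) with hT
  have hT0 : 0 < T := Real.rpow_pos_of_pos (by linarith [hD ‖u₀‖]) _
  have hTε : A * R ^ (p - 2) * T ^ slack p ≤ 1 / 4 := by
    rw [hT, ← Real.rpow_mul (by linarith [hD ‖u₀‖]), neg_mul, inv_mul_cancel₀ hε.ne',
      Real.rpow_neg_one, ← div_eq_mul_inv, div_le_iff₀ (by linarith [hD ‖u₀‖])]
    linarith
  have htime : ∀ x, 0 < min T (Real.exp x) := fun x => lt_min hT0 (Real.exp_pos x)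
  have hcont : ∀ W : ℝ →ᵇ FieldL2, Continuous fun x : ℝ =>
      (min T (Real.exp x)) ^ (1 / 4 : ℝ) • gradDuhamel p u₀ (ofLogTime W) (min T (Real.exp x)) := by
    intro W
    have hm : Continuous fun x : ℝ => min T (Real.exp x) := by fun_prop
    refine (hm.rpow_const fun _ => Or.inr (by norm_num)).smul ?_
    exact (continuousOn_gradDuhamel hp₂ hp₃ u₀ (norm_nonneg W) (continuousOn_ofLogTime W)
      fun s hs => norm_ofLogTime_le W hs).comp_continuous hm htime
  -- In logarithmic time, the weighted curves on `(0,∞)` become bounded continuous functions on `ℝ`,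
  -- a complete space. Stopping the clock at `T` by `min T (exp x)` extends the weighted value as a
  -- constant beyond `T`.
  let Φ : (ℝ →ᵇ FieldL2) → (ℝ →ᵇ FieldL2) := fun W =>
    BoundedContinuousFunction.ofNormedAddCommGroup _ (hcont W) _ fun x =>
      (hA u₀ W W ‖W‖ T _ le_rfl le_rfl (htime x) (min_le_left _ _)).1
  have hΦ : ∀ W x, Φ W x = (min T (Real.exp x)) ^ (1 / 4 : ℝ) •
      gradDuhamel p u₀ (ofLogTime W) (min T (Real.exp x)) := fun _ _ => rfl
  have hmaps : MapsTo Φ (Metric.closedBall 0 R) (Metric.closedBall 0 R) := by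
    intro W hW
    rw [mem_closedBall_zero_iff] at hW ⊢
    refine (BoundedContinuousFunction.norm_le hR.le).2 fun x => ?_
    refine ((hA u₀ W W R T _ hW hW (htime x) (min_le_left _ _)).1).trans ?_
    have hu : 4 * ‖u₀‖ ≤ R := by
      rw [hRdef, ballRadius, abs_of_nonneg (norm_nonneg _)]; linarith
    -- The datum contributes at most `R / 2` and the nonlinear term at most `R / 4`.
    nlinarith [mul_le_mul_of_nonneg_right hTε hR.le]
  have hlip : ContractingWith (1 / 2) (hmaps.restrict Φ _ _) := by
    refine ⟨by norm_num [← NNReal.coe_lt_coe], LipschitzWith.of_dist_le_mul fun W W' => ?_⟩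
    have hW := mem_closedBall_zero_iff.1 W.2
    have hW' := mem_closedBall_zero_iff.1 W'.2
    rw [Subtype.dist_eq, Subtype.dist_eq, dist_eq_norm, dist_eq_norm]
    change ‖Φ W - Φ W'‖ ≤ _
    refine (BoundedContinuousFunction.norm_le (by positivity)).2 fun x => ?_
    refine ((hA u₀ W W' R T _ hW hW' (htime x) (min_le_left _ _)).2).trans ?_
    refine mul_le_mul_of_nonneg_right ?_ (norm_nonneg _)
    push_cast
    linarith
  obtain ⟨W, hWmem, hWfix, -⟩ := ContractingWith.exists_fixedPoint'
    (Metric.isClosed_closedBall.isComplete) hmaps hlip (Metric.mem_closedBall_self hR.le)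
    (edist_ne_top _ _)
  refine ⟨ofLogTime W, ‖W‖, norm_nonneg _, continuousOn_ofLogTime W,
    fun s hs => norm_ofLogTime_le W hs, fun t ht => ?_⟩
  have hmin : min T (Real.exp (Real.log t)) = t := by
    rw [Real.exp_log ht.1, min_eq_right ht.2]
  have hcancel : t ^ (-(1 / 4) : ℝ) * t ^ (1 / 4 : ℝ) = 1 := by
    rw [← Real.rpow_add ht.1]; norm_num
  have hval : W (Real.log t) = Φ W (Real.log t) := by rw [hWfix.eq]
  rw [ofLogTime, hval, hΦ, hmin, smul_smul, hcancel, one_smul]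

/-! ### From the gradient to the solution -/

/-- The solution whose gradient is `G`, according to Duhamel's formula. -/
def duhamelL2 (p : ℝ) (u₀ : L2) (G : ℝ → FieldL2) (t : ℝ) : L2 :=
  semigroup t u₀ - ∫ s in (0 : ℝ)..t, divHeat (t - s) (fluxL1 p (G s))

lemma divSemigroup_flux_eq {p : ℝ} (hp₂ : 2 < p) (hp₃ : p < 3) {τ : ℝ} (hτ : 0 < τ)
    {g : Torus → Plane} {G : FieldL2} (h : g =ᵐ[dx] G) :
    divSemigroup τ (fun x => flux p (g x)) = divHeat τ (fluxL1 p G) := by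
  refine divSemigroup_eq_divHeat hτ ?_
  filter_upwards [h, fluxL1_ae hp₂ hp₃ G] with x h1 h2
  rw [h1, h2]

section Existence

variable {p : ℝ} {u₀ : L2} {G : ℝ → FieldL2} {R T : ℝ}

lemma intervalIntegrable_divHeat_flux (hp₂ : 2 < p) (hp₃ : p < 3) (hR : 0 ≤ R) (hGc : ContinuousOn G (Ioi 0))
    (hG : ∀ s, 0 < s → ‖G s‖ ≤ R * s ^ (-(1 / 4) : ℝ)) {t : ℝ} (ht : 0 < t) :
    IntervalIntegrable (fun s => divHeat (t - s) (fluxL1 p (G s))) volume 0 t := by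
  obtain ⟨C, hC⟩ := exists_divHeat_bound hp₂ hp₃
  exact intervalIntegrable_convolution (by unfold slack; linarith) (fluxExp_lt_one hp₃)
    continuousOn_divHeat hC ((continuous_fluxL1 hp₂ hp₃).comp_continuousOn hGc)
    (fun s hs => norm_fluxL1_le_singular hp₂ hp₃ hR hs (hG s hs)) ht

lemma intervalIntegrable_gradDivHeat_flux (hp₂ : 2 < p) (hp₃ : p < 3) (hR : 0 ≤ R) (hGc : ContinuousOn G (Ioi 0))
    (hG : ∀ s, 0 < s → ‖G s‖ ≤ R * s ^ (-(1 / 4) : ℝ)) {t : ℝ} (ht : 0 < t) :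
    IntervalIntegrable (fun s => gradDivHeat (t - s) (fluxL1 p (G s))) volume 0 t := by
  obtain ⟨C, -, hC⟩ := exists_gradDivHeat_bound hp₂ hp₃
  exact intervalIntegrable_convolution (kernelExp_lt_one hp₂) (fluxExp_lt_one hp₃)
    continuousOn_gradDivHeat hC ((continuous_fluxL1 hp₂ hp₃).comp_continuousOn hGc)
    (fun s hs => norm_fluxL1_le_singular hp₂ hp₃ hR hs (hG s hs)) ht

lemma continuousOn_duhamelL2 (hp₂ : 2 < p) (hp₃ : p < 3) (hR : 0 ≤ R) (hGc : ContinuousOn G (Ioi 0))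
    (hG : ∀ s, 0 < s → ‖G s‖ ≤ R * s ^ (-(1 / 4) : ℝ)) :
    ContinuousOn (duhamelL2 p u₀ G) (Ici 0) := by
  obtain ⟨C, hC⟩ := exists_divHeat_bound hp₂ hp₃
  refine (continuousOn_semigroup u₀).sub ?_
  exact continuousOn_convolution_Ici (by unfold slack; linarith) (fluxExp_lt_one hp₃)
    (by unfold slack fluxExp; linarith)
    continuousOn_divHeat hC ((continuous_fluxL1 hp₂ hp₃).comp_continuousOn hGc)
    (fun s hs => norm_fluxL1_le_singular hp₂ hp₃ hR hs (hG s hs))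

lemma isWeakGradient_duhamelL2 (hp₂ : 2 < p) (hp₃ : p < 3) (hR : 0 ≤ R) (hGc : ContinuousOn G (Ioi 0))
    (hG : ∀ s, 0 < s → ‖G s‖ ≤ R * s ^ (-(1 / 4) : ℝ)) {t : ℝ} (ht : 0 < t) :
    IsWeakGradient (duhamelL2 p u₀ G t) (gradDuhamel p u₀ G t) := by
  refine (isWeakGradient_gradHeat u₀ ht).sub ?_
  refine isWeakGradient_intervalIntegral ht.le
    (intervalIntegrable_divHeat_flux hp₂ hp₃ hR hGc hG ht)
    (intervalIntegrable_gradDivHeat_flux hp₂ hp₃ hR hGc hG ht) fun s hs => ?_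
  exact isWeakGradient_gradDivHeat _ (sub_pos.2 hs.2)

lemma memSolutionSpace_duhamelL2 (hp₂ : 2 < p) (hp₃ : p < 3) (hR : 0 ≤ R) (hGc : ContinuousOn G (Ioi 0))
    (hG : ∀ s, 0 < s → ‖G s‖ ≤ R * s ^ (-(1 / 4) : ℝ))
    (hfix : ∀ t ∈ Ioc 0 T, G t = gradDuhamel p u₀ G t) :
    MemSolutionSpace T (duhamelL2 p u₀ G) := by
  refine ⟨(continuousOn_duhamelL2 hp₂ hp₃ hR hGc hG).mono Icc_subset_Ici_self, R, fun t ht =>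
    ⟨G t, ?_, ?_⟩⟩
  · rw [hfix t ht]
    exact isWeakGradient_duhamelL2 hp₂ hp₃ hR hGc hG ht.1
  · have hcancel : t ^ (1 / 4 : ℝ) * t ^ (-(1 / 4) : ℝ) = 1 := by
      rw [← Real.rpow_add ht.1]; norm_num
    calc t ^ (1 / 4 : ℝ) * ‖G t‖ ≤ t ^ (1 / 4 : ℝ) * (R * t ^ (-(1 / 4) : ℝ)) :=
          mul_le_mul_of_nonneg_left (hG t ht.1) (Real.rpow_nonneg ht.1.le _)
      _ = R * (t ^ (1 / 4 : ℝ) * t ^ (-(1 / 4) : ℝ)) := by ring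
      _ = R := by rw [hcancel, mul_one]

lemma isMildSolution_duhamelL2 (hp₂ : 2 < p) (hp₃ : p < 3) (hR : 0 ≤ R) (hT : 0 < T) (hGc : ContinuousOn G (Ioi 0))
    (hG : ∀ s, 0 < s → ‖G s‖ ≤ R * s ^ (-(1 / 4) : ℝ))
    (hfix : ∀ t ∈ Ioc 0 T, G t = gradDuhamel p u₀ G t) :
    IsMildSolution p T u₀ (duhamelL2 p u₀ G) := by
  have hae : ∀ s, (inclL1 Plane (G s) : Torus → Plane) =ᵐ[dx] G s := fun s => inclL1_ae _
  refine ⟨(continuousOn_duhamelL2 hp₂ hp₃ hR hGc hG).mono Icc_subset_Ici_self,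
    fun s => inclL1 Plane (G s), ?_, ?_, fun t ht => ?_⟩
  · rw [integrableOn_Icc_iff_integrableOn_Ioc]
    have hpow : IntegrableOn (fun s : ℝ => R * s ^ (-(1 / 4) : ℝ)) (Ioc 0 T) :=
      ((intervalIntegrable_iff_integrableOn_Ioc_of_le hT.le).1
        (intervalIntegral.intervalIntegrable_rpow' (by norm_num))).const_mul R
    refine Integrable.mono' hpow ?_ ?_
    · exact (((inclL1 Plane).continuous.comp_continuousOn hGc).mono
        Ioc_subset_Ioi_self).aestronglyMeasurable measurableSet_Ioc
    · exact (ae_restrict_iff' measurableSet_Ioc).2 (ae_of_all _ fun s hs =>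
        (norm_inclL1_le _).trans (hG s hs.1))
  · rw [Measure.restrict_congr_set Ioc_ae_eq_Icc.symm]
    refine (ae_restrict_iff' measurableSet_Ioc).2 (ae_of_all _ fun s hs => ⟨?_, ?_⟩)
    · refine IsWeakGradient.congr_ae ?_ (hae s).symm
      rw [hfix s hs]
      exact isWeakGradient_duhamelL2 hp₂ hp₃ hR hGc hG hs.1
    · refine (memLp_one_iff_integrable.1 (memLp_flux hp₂ hp₃ (G s))).congr ?_
      filter_upwards [hae s] with x hx
      rw [hx]
  · rcases eq_or_lt_of_le ht.1 with rfl | h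
    · refine ⟨by simp, ?_⟩
      simp [duhamelL2, duhamel]
    -- The endpoint `s = t` is left out: `divHeat 0` is zero by default, which says nothing about
    -- `divSemigroup 0`.
    have hcongr : ∀ s ∈ Ioo 0 t, divHeat (t - s) (fluxL1 p (G s))
        = divSemigroup (t - s) (fun x => flux p (inclL1 Plane (G s) x)) := fun s hs =>
      (divSemigroup_flux_eq hp₂ hp₃ (sub_pos.2 hs.2) (hae s)).symm
    constructor
    · have hint := intervalIntegrable_divHeat_flux hp₂ hp₃ hR hGc hG h
      rw [intervalIntegrable_iff_integrableOn_Ioo_of_le h.le] at hint ⊢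
      exact hint.congr_fun hcongr measurableSet_Ioo
    · rw [duhamelL2, duhamel, intervalIntegral.integral_of_le h.le,
        intervalIntegral.integral_of_le h.le, integral_Ioc_eq_integral_Ioo,
        integral_Ioc_eq_integral_Ioo, setIntegral_congr_fun measurableSet_Ioo hcongr]

end Existence

/-! ### Uniqueness -/

/-- A mild solution in the solution space satisfies Duhamel's formula with its square integrable
gradient. -/
lemma IsMildSolution.exists_gradient {p T : ℝ} (hp₂ : 2 < p) (hp₃ : p < 3) {u₀ : L2}
    {u : ℝ → L2} (hu : IsMildSolution p T u₀ u) (hu' : MemSolutionSpace T u) :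
    ∃ (g : ℝ → FieldL2) (M : ℝ),
      (∀ t ∈ Ioc 0 T, IsWeakGradient (u t) (g t) ∧ ‖g t‖ ≤ M * t ^ (-(1 / 4) : ℝ)) ∧
      ∀ t ∈ Icc 0 T,
        IntervalIntegrable (fun s => divHeat (t - s) (fluxL1 p (g s))) volume 0 t ∧
        u t = duhamelL2 p u₀ g t := by
  obtain ⟨-, G, -, hGgrad, hGmild⟩ := hu
  obtain ⟨-, M, hM⟩ := hu'
  -- The gradients are picked time by time, so no measurability of `g` in time is available.
  choose! g hg using hM
  refine ⟨g, M, fun t ht => ⟨(hg t ht).1, ?_⟩, fun t ht => ?_⟩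
  · have hcancel : t ^ (1 / 4 : ℝ) * t ^ (-(1 / 4) : ℝ) = 1 := by
      rw [← Real.rpow_add ht.1]; norm_num
    calc ‖g t‖ = t ^ (1 / 4 : ℝ) * ‖g t‖ * t ^ (-(1 / 4) : ℝ) := by
          rw [mul_right_comm, hcancel, one_mul]
      _ ≤ M * t ^ (-(1 / 4) : ℝ) :=
          mul_le_mul_of_nonneg_right (hg t ht).2 (Real.rpow_nonneg ht.1.le _)
  · have hcongr : (fun s => divSemigroup (t - s) (fun x => flux p (G s x)))
        =ᵐ[volume.restrict (Ioc 0 t)] fun s => divHeat (t - s) (fluxL1 p (g s)) := by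
      have h1 := ae_restrict_of_ae_restrict_of_subset
        (Ioc_subset_Icc_self.trans (Icc_subset_Icc_right ht.2)) hGgrad
      have hne : ∀ᵐ s ∂(volume.restrict (Ioc 0 t)), s ≠ t :=
        ae_restrict_of_ae (by simp [ae_iff])
      filter_upwards [h1, hne, ae_restrict_mem measurableSet_Ioc] with s h2 h3 h4
      have hs : s ∈ Ioc 0 T := ⟨h4.1, h4.2.trans ht.2⟩
      exact divSemigroup_flux_eq hp₂ hp₃ (sub_pos.2 (lt_of_le_of_ne h4.2 h3))
        (h2.1.ae_unique (hg s hs).1)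
    obtain ⟨h1, h2⟩ := hGmild t ht
    constructor
    · rw [intervalIntegrable_iff_integrableOn_Ioc_of_le ht.1] at h1 ⊢
      exact h1.congr hcongr
    · rw [h2, duhamel, duhamelL2, intervalIntegral.integral_of_le ht.1,
        intervalIntegral.integral_of_le ht.1, integral_congr_ae hcongr]

/-- The gain from an exponential weight in time. -/
lemma exp_mul_le_of_weight {l s t ε : ℝ} (hl : 0 < l) (hst : s < t) (hε₀ : 0 ≤ ε) (hε₁ : ε ≤ 1) :
    Real.exp (l * s) ≤ Real.exp (l * t) * l ^ (-ε) * (t - s) ^ (-ε) := by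
  have h := exp_neg_le_rpow_neg (x := l * (t - s)) (mul_pos hl (sub_pos.2 hst)) hε₀ hε₁
  rw [Real.mul_rpow hl.le (sub_pos.2 hst).le] at h
  calc Real.exp (l * s) = Real.exp (l * t) * Real.exp (-(l * (t - s))) := by
        rw [← Real.exp_add]; ring_nf
    _ ≤ Real.exp (l * t) * (l ^ (-ε) * (t - s) ^ (-ε)) := by gcongr
    _ = _ := by ring

/-- The difference of two mild solutions is contracted in an exponentially weighted norm. -/
lemma exists_weighted_contraction {p : ℝ} (hp₂ : 2 < p) (hp₃ : p < 3) {M : ℝ} (hM : 0 ≤ M) :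
    ∃ l, 0 < l ∧ ∀ (T : ℝ) (u₀ : L2) (u v : ℝ → L2) (g h : ℝ → FieldL2),
      (∀ t ∈ Ioc 0 T, IsWeakGradient (u t) (g t) ∧ ‖g t‖ ≤ M * t ^ (-(1 / 4) : ℝ)) →
      (∀ t ∈ Ioc 0 T, IsWeakGradient (v t) (h t) ∧ ‖h t‖ ≤ M * t ^ (-(1 / 4) : ℝ)) →
      (∀ t ∈ Icc 0 T, IntervalIntegrable (fun s => divHeat (t - s) (fluxL1 p (g s))) volume 0 t ∧
        u t = duhamelL2 p u₀ g t) →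
      (∀ t ∈ Icc 0 T, IntervalIntegrable (fun s => divHeat (t - s) (fluxL1 p (h s))) volume 0 t ∧
        v t = duhamelL2 p u₀ h t) →
      ∀ A, 0 ≤ A →
      (∀ t ∈ Ioc 0 T, ‖g t - h t‖ ≤ A * Real.exp (l * t) * t ^ (-(1 / 4) : ℝ)) →
      ∀ t ∈ Ioc 0 T, ‖g t - h t‖ ≤ A / 2 * Real.exp (l * t) * t ^ (-(1 / 4) : ℝ) := by
  obtain ⟨C, hC0, hC⟩ := exists_gradDivHeat_bound hp₂ hp₃
  have hε := slack_pos hp₃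
  -- The kernel exponent including the weight is `3/4 + 2ε = 3/4 + (3-p)/4`; it is below one because
  -- `p > 2`.
  have ha : kernelExp p + slack p < 1 := by unfold kernelExp slack; linarith
  have ha0 : 0 ≤ kernelExp p := by unfold kernelExp slack; linarith
  have hb := fluxExp_lt_one hp₃
  set B := betaConst (kernelExp p + slack p) (fluxExp p) with hB
  have hB0 : 0 ≤ B := betaConst_nonneg _ _
  have hD : 0 < 4 * (C * M ^ (p - 2) * B) + 1 := by positivity
  refine ⟨(4 * (C * M ^ (p - 2) * B) + 1) ^ (slack p)⁻¹, Real.rpow_pos_of_pos hD _, ?_⟩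
  set l := (4 * (C * M ^ (p - 2) * B) + 1) ^ (slack p)⁻¹ with hl
  have hl0 : 0 < l := Real.rpow_pos_of_pos hD _
  have hlε : C * M ^ (p - 2) * B * l ^ (-slack p) ≤ 1 / 4 := by
    rw [hl, ← Real.rpow_mul hD.le, mul_neg, inv_mul_cancel₀ hε.ne', Real.rpow_neg_one,
      ← div_eq_mul_inv, div_le_iff₀ hD]
    linarith
  intro T u₀ u v g h hg hh hu hv A hA hbound t ht
  have htI : t ∈ Icc 0 T := Ioc_subset_Icc_self ht
  obtain ⟨hui, hu⟩ := hu t htI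
  obtain ⟨hvi, hv⟩ := hv t htI
  have hdiff : u t - v t
      = -∫ s in (0 : ℝ)..t, divHeat (t - s) (fluxL1 p (g s) - fluxL1 p (h s)) := by
    simp only [map_sub]
    rw [intervalIntegral.integral_sub hui hvi, hu, hv, duhamelL2, duhamelL2]
    abel
  have hinti : IntervalIntegrable
      (fun s => divHeat (t - s) (fluxL1 p (g s) - fluxL1 p (h s))) volume 0 t := by
    simp only [map_sub]
    exact hui.sub hvi
  set E := 2 * (C * M ^ (p - 2)) * A * (Real.exp (l * t) * l ^ (-slack p)) with hE
  -- The gradient is regularised by `e^{-δΔ²}`. The bounded operator `gradHeat δ` passes through the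
  -- `L²`-valued integral, whose convergence is part of being a mild solution, so integrability of
  -- the `∇∇·` integrand itself is never needed. The bound is uniform in `δ`.
  have hreg : ∀ δ, 0 < δ → ‖gradHeat δ (u t - v t)‖ ≤ E * (B * t ^ (-(1 / 4) : ℝ)) := by
    intro δ hδ
    have hker := (intervalIntegrable_singular_kernel ha hb ht.1).const_mul E
    -- The choice of `ε` makes the output power exactly the weight `t^{-1/4}`, so the estimate
    -- closes with no smallness of `T`.
    have hexp : 1 - (kernelExp p + slack p) - fluxExp p = -(1 / 4) := by
      unfold kernelExp slack fluxExp; ring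
    rw [hdiff, map_neg, norm_neg, ← ContinuousLinearMap.intervalIntegral_comp_comm _ hinti, hB,
      ← hexp, ← integral_singular_kernel ht.1, ← intervalIntegral.integral_const_mul,
      intervalIntegral.integral_of_le ht.1.le, intervalIntegral.integral_of_le ht.1.le,
      integral_Ioc_eq_integral_Ioo, integral_Ioc_eq_integral_Ioo]
    rw [intervalIntegrable_iff_integrableOn_Ioo_of_le ht.1.le] at hker
    refine norm_integral_le_of_norm_le hker ((ae_restrict_iff' measurableSet_Ioo).2
      (ae_of_all _ fun s hs => ?_))
    have hτ : 0 < t - s := sub_pos.2 hs.2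
    have hsT : s ∈ Ioc 0 T := ⟨hs.1, hs.2.le.trans ht.2⟩
    rw [gradHeat_divHeat_eq hδ hτ]
    have h1 : ‖gradDivHeat (δ + (t - s))‖ ≤ C * (t - s) ^ (-kernelExp p) := by
      refine (hC _ (by linarith)).trans (mul_le_mul_of_nonneg_left ?_ hC0)
      exact Real.rpow_le_rpow_of_nonpos hτ (by linarith) (by linarith)
    have h2 := norm_fluxL1_sub_le_singular hp₂ hp₃ hM hs.1 (hg s hsT).2 (hh s hsT).2
      (hbound s hsT)
    have h3 := exp_mul_le_of_weight hl0 hs.2 hε.le (by unfold slack; linarith : slack p ≤ 1)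
    have hs0 := hs.1
    calc ‖gradDivHeat (δ + (t - s)) (fluxL1 p (g s) - fluxL1 p (h s))‖
        ≤ (C * (t - s) ^ (-kernelExp p))
          * (2 * M ^ (p - 2) * (A * Real.exp (l * s)) * s ^ (-fluxExp p)) :=
          ((gradDivHeat _).le_of_opNorm_le h1 _).trans
            (mul_le_mul_of_nonneg_left h2 (by positivity))
      _ ≤ (C * (t - s) ^ (-kernelExp p))
          * (2 * M ^ (p - 2) * (A * (Real.exp (l * t) * l ^ (-slack p) * (t - s) ^ (-slack p)))
            * s ^ (-fluxExp p)) := by gcongr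
      _ = E * ((t - s) ^ (-(kernelExp p + slack p)) * s ^ (-fluxExp p)) := by
          rw [neg_add, Real.rpow_add hτ]
          ring
  have hlim := ((hg t ht).1.sub (hh t ht).1).tendsto_gradHeat.norm
  have hle : ‖g t - h t‖ ≤ E * (B * t ^ (-(1 / 4) : ℝ)) :=
    le_of_tendsto hlim (eventually_mem_nhdsWithin.mono fun δ hδ => hreg δ hδ)
  refine hle.trans ?_
  have ht0 := ht.1
  calc E * (B * t ^ (-(1 / 4) : ℝ))
      = 2 * (C * M ^ (p - 2) * B * l ^ (-slack p)) * (A * Real.exp (l * t)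
          * t ^ (-(1 / 4) : ℝ)) := by rw [hE]; ring
    _ ≤ 2 * (1 / 4) * (A * Real.exp (l * t) * t ^ (-(1 / 4) : ℝ)) := by gcongr
    _ = _ := by ring

lemma IsMildSolution.eqOn {p T : ℝ} (hp₂ : 2 < p) (hp₃ : p < 3) {u₀ : L2} {u v : ℝ → L2}
    (hu : IsMildSolution p T u₀ u) (hu' : MemSolutionSpace T u) (hv : IsMildSolution p T u₀ v)
    (hv' : MemSolutionSpace T v) : EqOn u v (Icc 0 T) := by
  obtain ⟨g, M₁, hg, hud⟩ := hu.exists_gradient hp₂ hp₃ hu'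
  obtain ⟨h, M₂, hh, hvd⟩ := hv.exists_gradient hp₂ hp₃ hv'
  -- The `0` covers an empty time interval, where nothing forces the bounds to be nonnegative.
  set M := max 0 (max M₁ M₂) with hMdef
  have hM : 0 ≤ M := le_max_left _ _
  have hM₁ : M₁ ≤ M := (le_max_left _ _).trans (le_max_right _ _)
  have hM₂ : M₂ ≤ M := (le_max_right _ _).trans (le_max_right _ _)
  have hgM : ∀ t ∈ Ioc 0 T, IsWeakGradient (u t) (g t) ∧ ‖g t‖ ≤ M * t ^ (-(1 / 4) : ℝ) :=
    fun t ht => ⟨(hg t ht).1, (hg t ht).2.trans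
      (mul_le_mul_of_nonneg_right hM₁ (Real.rpow_nonneg ht.1.le _))⟩
  have hhM : ∀ t ∈ Ioc 0 T, IsWeakGradient (v t) (h t) ∧ ‖h t‖ ≤ M * t ^ (-(1 / 4) : ℝ) :=
    fun t ht => ⟨(hh t ht).1, (hh t ht).2.trans
      (mul_le_mul_of_nonneg_right hM₂ (Real.rpow_nonneg ht.1.le _))⟩
  obtain ⟨l, hl, hcontr⟩ := exists_weighted_contraction hp₂ hp₃ hM
  have hiter : ∀ n : ℕ, ∀ t ∈ Ioc 0 T,
      ‖g t - h t‖ ≤ 2 * M * (1 / 2) ^ n * Real.exp (l * t) * t ^ (-(1 / 4) : ℝ) := by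
    intro n
    induction n with
    | zero =>
      intro t ht
      have ht0 := ht.1
      have hexp : 1 ≤ Real.exp (l * t) := Real.one_le_exp (by positivity)
      calc ‖g t - h t‖ ≤ M * t ^ (-(1 / 4) : ℝ) + M * t ^ (-(1 / 4) : ℝ) :=
            (norm_sub_le _ _).trans (add_le_add (hgM t ht).2 (hhM t ht).2)
        _ = 2 * M * (1 / 2) ^ 0 * 1 * t ^ (-(1 / 4) : ℝ) := by ring
        _ ≤ 2 * M * (1 / 2) ^ 0 * Real.exp (l * t) * t ^ (-(1 / 4) : ℝ) := by gcongr
    | succ n ih =>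
      intro t ht
      refine (hcontr T u₀ u v g h hgM hhM hud hvd _ (by positivity) ih t ht).trans_eq ?_
      rw [pow_succ]
      ring
  have hgh : ∀ t ∈ Ioc 0 T, g t = h t := by
    intro t ht
    have hlim : Tendsto (fun n : ℕ => 2 * M * (1 / 2 : ℝ) ^ n * Real.exp (l * t)
        * t ^ (-(1 / 4) : ℝ)) atTop (𝓝 (2 * M * 0 * Real.exp (l * t) * t ^ (-(1 / 4) : ℝ))) :=
      (((tendsto_pow_atTop_nhds_zero_of_lt_one (by norm_num) (by norm_num)).const_mul _).mul_const
        _).mul_const _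
    rw [mul_zero, zero_mul, zero_mul] at hlim
    exact sub_eq_zero.1 (norm_le_zero_iff.1
      (ge_of_tendsto hlim (Eventually.of_forall fun n => hiter n t ht)))
  -- Equal gradients on `(0,T]` give equal Duhamel integrals, hence equal solutions, including at `t
  -- = 0` where the integral is empty.
  intro t ht
  rw [(hud t ht).2, (hvd t ht).2, duhamelL2, duhamelL2, intervalIntegral.integral_of_le ht.1,
    intervalIntegral.integral_of_le ht.1]
  congr 1
  refine setIntegral_congr_fun measurableSet_Ioc fun s hs => ?_
  simp only [hgh s ⟨hs.1, hs.2.trans ht.2⟩]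

end ThinFilm

end

theorem mainTheorem4 (p : ℝ) (hp₂ : 2 < p) (hp₃ : p < 3) :
    ∃ T : ℝ → ℝ, (∀ r, 0 < T r ∧ T r ≤ 1) ∧
      ∀ u₀ : ThinFilm.L2,
        ∃ u : ℝ → ThinFilm.L2,
          ThinFilm.IsMildSolution p (T ‖u₀‖) u₀ u ∧
          ThinFilm.MemSolutionSpace (T ‖u₀‖) u ∧
          ∀ v : ℝ → ThinFilm.L2,
            ThinFilm.IsMildSolution p (T ‖u₀‖) u₀ v →
            ThinFilm.MemSolutionSpace (T ‖u₀‖) v →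
            Set.EqOn v u (Set.Icc 0 (T ‖u₀‖)) := by
  obtain ⟨T, hT, h⟩ := ThinFilm.exists_gradDuhamel_fixedPoint hp₂ hp₃
  refine ⟨T, hT, fun u₀ => ?_⟩
  obtain ⟨G, R, hR, hGc, hG, hfix⟩ := h u₀
  have hmild := ThinFilm.isMildSolution_duhamelL2 hp₂ hp₃ hR (hT ‖u₀‖).1 hGc hG hfix
  have hmem := ThinFilm.memSolutionSpace_duhamelL2 hp₂ hp₃ hR hGc hG hfix
  exact ⟨ThinFilm.duhamelL2 p u₀ G, hmild, hmem, fun v hv hv' =>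
    hv.eqOn hp₂ hp₃ hv' hmild hmem⟩
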